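/- Let $X=\{f=0\}\subset\mathbb{P}^4$ be a smooth complex cubic threefold and let $p\in X$ be an Eckardt point, that is, a point at which the cubic $X\cap T_pX\subset T_pX$ has multiplicity three, where $T_pX$ is the projective tangent space of $X$ at $p$. A line $\ell\subset X$ is called of the second type if there is a unique $2$-plane $P\supset\ell$ tangent to $X$ at all points of $\ell$; it is called a triple line if it is of the second type and $P\cap X=3\ell$, i.e. in $P\cap X=2\ell\cup\ell'$ the residual line $\ell'$ is equal to $\ell$. Then exactly nine triple lines on $X$ pass through $p$. Moreover, for every $2$-plane $H\subset T_pX$ with $p\notin H$, the intersection $X\cap T_pX$ is the cone with vertex $p$ over $E_p:=X\cap H$, the curve $E_p$ is a smooth plane cubic with exactly nine inflection points (points $a\in E_p$ at which the tangent line of $E_p$ at $a$ meets $E_p$ with multiplicity three), and $a\mapsto \overline{pa}$ is a bijection from the set of inflection points of $E_p$ onto the set of triple lines on $X$ passing through $p$. -/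

import Mathlib

open scoped LinearAlgebra.Projectivization

namespace CubicThreefold

/-- The vector space whose projectivization is `ℙ⁴`. Linear subspaces of `ℙ⁴` of (projective)
dimension `k` are the linear subspaces of `ℂ⁵` of dimension `k + 1`; a point `p` lies on the
linear subspace `W` when `p.submodule ≤ W`. -/
abbrev V : Type := Fin 5 → ℂ

/-- The points of `ℙ⁴`. -/
abbrev P4 : Type := ℙ ℂ V

/-- `f` is the equation of a smooth cubic threefold in `ℙ⁴`: a cubic form satisfying the
Jacobian criterion (this forces `f ≠ 0`). -/
def IsSmoothCubic (f : MvPolynomial (Fin 5) ℂ) : Prop :=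
  f.IsHomogeneous 3 ∧
    ∀ x : V, x ≠ 0 → MvPolynomial.eval x f = 0 →
      ∃ i, MvPolynomial.eval x (MvPolynomial.pderiv i f) ≠ 0

/-- The hypersurface `X = {f = 0} ⊂ ℙ⁴`, for a form `f`. -/
def zeroLocus (f : MvPolynomial (Fin 5) ℂ) : Set P4 :=
  {q | MvPolynomial.eval q.rep f = 0}

/-- The projective tangent space `T_q X = {w | ∑ i, ∂f/∂xᵢ(q) wᵢ = 0}` at `q`; for a form `f` it
does not depend on the representative of `q`. -/
noncomputable def tangentSpace (f : MvPolynomial (Fin 5) ℂ) (q : P4) : Submodule ℂ V :=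
  LinearMap.ker
    (∑ i, MvPolynomial.eval q.rep (MvPolynomial.pderiv i f) •
      (LinearMap.proj i : V →ₗ[ℂ] ℂ))

/-- The one-variable polynomial `t ↦ f (v + t w)`. -/
noncomputable def alongLine (f : MvPolynomial (Fin 5) ℂ) (v w : V) : Polynomial ℂ :=
  MvPolynomial.aeval (fun i => Polynomial.C (v i) + Polynomial.X * Polynomial.C (w i)) f

/-- The multiplicity at `q` of `X ∩ W ⊂ W`, for a linear subspace `W` through `q`: the order of
vanishing at `q` of the restriction of `f` to `W`, that is the least order of vanishing at `t = 0`
of `f (q + t w)` for `w ∈ W`. It is `0` when `q ∉ X`, and `⊤` when `W ⊆ X`. -/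
noncomputable def multiplicityIn (f : MvPolynomial (Fin 5) ℂ) (W : Submodule ℂ V) (q : P4) : ℕ∞ :=
  ⨅ w ∈ W, emultiplicity (Polynomial.X : Polynomial ℂ) (alongLine f q.rep w)

/-- `p ∈ X` is an Eckardt point: the cubic `X ∩ T_p X ⊂ T_p X` has multiplicity three at `p`. -/
def IsEckardtPoint (f : MvPolynomial (Fin 5) ℂ) (p : P4) : Prop :=
  p ∈ zeroLocus f ∧ multiplicityIn f (tangentSpace f p) p = 3

/-- `ℓ` is a line contained in `X`. -/
def IsLineOn (f : MvPolynomial (Fin 5) ℂ) (ℓ : Submodule ℂ V) : Prop :=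
  Module.finrank ℂ ℓ = 2 ∧ ∀ q : P4, q.submodule ≤ ℓ → q ∈ zeroLocus f

/-- `P` is a 2-plane containing `ℓ` and tangent to `X` at all points of `ℓ`. -/
def IsPlaneTangentAlong (f : MvPolynomial (Fin 5) ℂ) (ℓ P : Submodule ℂ V) : Prop :=
  Module.finrank ℂ P = 3 ∧ ℓ ≤ P ∧ ∀ q : P4, q.submodule ≤ ℓ → P ≤ tangentSpace f q

/-- `ℓ` is a line of the second type on `X`: there is a unique 2-plane containing `ℓ` and tangent
to `X` at all points of `ℓ`. -/
def IsSecondType (f : MvPolynomial (Fin 5) ℂ) (ℓ : Submodule ℂ V) : Prop :=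
  IsLineOn f ℓ ∧ ∃! P : Submodule ℂ V, IsPlaneTangentAlong f ℓ P

/-- `P ∩ X = 2ℓ ∪ ℓ'` as plane cubics: on the 2-plane `P`, `f` is the product of the square of a
linear form cutting out the line `ℓ` in `P` and a linear form cutting out the line `ℓ'` in `P`. -/
def PlaneSectionEq (f : MvPolynomial (Fin 5) ℂ) (P ℓ ℓ' : Submodule ℂ V) : Prop :=
  ∃ a b : V →ₗ[ℂ] ℂ, P ⊓ LinearMap.ker a = ℓ ∧ P ⊓ LinearMap.ker b = ℓ' ∧
    ∀ x ∈ P, MvPolynomial.eval x f = a x ^ 2 * b x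

/-- `ℓ'` is the residual line of the line of the second type `ℓ`: `P ∩ X = 2ℓ ∪ ℓ'`, where `P` is
the 2-plane tangent to `X` along `ℓ`. -/
def IsResidualLine (f : MvPolynomial (Fin 5) ℂ) (ℓ ℓ' : Submodule ℂ V) : Prop :=
  Module.finrank ℂ ℓ' = 2 ∧
    ∃ P : Submodule ℂ V, IsPlaneTangentAlong f ℓ P ∧ PlaneSectionEq f P ℓ ℓ'

/-- A triple line on `X`: a line of the second type that is its own residual line. -/
def IsTripleLine (f : MvPolynomial (Fin 5) ℂ) (ℓ : Submodule ℂ V) : Prop :=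
  IsSecondType f ℓ ∧ IsResidualLine f ℓ ℓ

/-- The points of `X ∩ H`, for a linear subspace `H`. -/
def linearSection (f : MvPolynomial (Fin 5) ℂ) (H : Submodule ℂ V) : Set P4 :=
  {a | a ∈ zeroLocus f ∧ a.submodule ≤ H}

/-- `X ∩ H` is a smooth hypersurface of `H`: the differential of the restriction of `f` to `H` is
nonzero at each point of `X ∩ H` (this forces the restriction of `f` to `H` to be nonzero when
`H ≠ 0`). -/
def IsSmoothSection (f : MvPolynomial (Fin 5) ℂ) (H : Submodule ℂ V) : Prop :=
  ∀ a ∈ linearSection f H, ¬ H ≤ tangentSpace f a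

/-- `a` is an inflection point of the plane curve `E = X ∩ H` in the 2-plane `H`: it is a smooth
point of `E`, and the intersection of `E` with its tangent line `H ∩ T_a X` at `a` has
multiplicity three at `a`. -/
def IsInflectionPoint (f : MvPolynomial (Fin 5) ℂ) (H : Submodule ℂ V) (a : P4) : Prop :=
  a ∈ linearSection f H ∧ ¬ H ≤ tangentSpace f a ∧
    multiplicityIn f (H ⊓ tangentSpace f a) a = 3

end CubicThreefold

/-! Write f(x) = T(x, x, x) with T symmetric trilinear, and let W be the tangent space at p.
Multiplicity three at p says that T(p, w, w) = 0 on W, and polarizing gives T(p, w, u) = 0 for w, u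
in W. Hence T on W does not change when its arguments move by multiples of p
(`IsPolarization.apply_cone`), which makes X ∩ W a cone over E = X ∩ H.

A singular point a of E would give a singular point of X. At s•p + a the differential of f vanishes
on W, and its value on a fixed u outside W is, up to a factor, a quadratic polynomial in s with
nonzero leading coefficient, so it has a root (`IsPolarization.isSmoothTrilinear_restrict`).

A line on X through p lies in W, so it joins p to a point a of E. The only plane tangent to X along
it is W ∩ T_aX. On that plane f is the restriction of f to the tangent line of E at a, pulled back
by projection from p. It is a cube with zero locus the line exactly when a is a flex
(`IsPolarization.isTripleLine_iff`), so triple lines through p correspond to flexes of E.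

It remains to count the flexes of a smooth plane cubic (`ncard_isFlexVector`). Krull's height
theorem gives a common zero of the cubic and its Hessian. That flex leads to a Weierstrass normal
form, where the flex at infinity is joined by eight affine ones. -/

namespace CubicThreefold


/-! ### Common zeros of two polynomials in three variables -/

/-- The maximal ideal of the origin in `ℂ[x, y, z]` has height at least three. -/
theorem three_le_height_ker_eval_zero :
    3 ≤ (RingHom.ker (MvPolynomial.eval (0 : Fin 3 → ℂ))).height := by
  -- The substitutions x = 0 and x = y = 0 map into a domain, so their kernels are prime. With the
  -- zero ideal and the maximal ideal they form a strict chain of length three, in which X 0, X 1, X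
  -- 2 witness the strictness.
  let φ₁ : MvPolynomial (Fin 3) ℂ →+* MvPolynomial (Fin 3) ℂ :=
    (MvPolynomial.bind₁ ![0, MvPolynomial.X 1, MvPolynomial.X 2]).toRingHom
  let φ₂ : MvPolynomial (Fin 3) ℂ →+* MvPolynomial (Fin 3) ℂ :=
    (MvPolynomial.bind₁ ![0, 0, MvPolynomial.X 2]).toRingHom
  have h21 : φ₂.comp φ₁ = φ₂ := by
    ext i
    · simp [φ₁, φ₂]
    · fin_cases i <;> simp [φ₁, φ₂]
  have h32 : (MvPolynomial.eval (0 : Fin 3 → ℂ)).comp φ₂ = MvPolynomial.eval 0 := by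
    ext i
    · simp [φ₂]
    · fin_cases i <;> simp [φ₂]
  have l0 : (⊥ : Ideal (MvPolynomial (Fin 3) ℂ)) < RingHom.ker φ₁ := by
    refine bot_lt_iff_ne_bot.2 fun h => ?_
    have : MvPolynomial.X 0 ∈ RingHom.ker φ₁ := by simp [RingHom.mem_ker, φ₁]
    rw [h] at this
    simp at this
  have l1 : RingHom.ker φ₁ < RingHom.ker φ₂ := by
    refine lt_of_le_of_ne (fun x hx => ?_) fun h => ?_
    · rw [RingHom.mem_ker] at hx ⊢
      rw [← h21, RingHom.comp_apply, hx, map_zero]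
    · have : MvPolynomial.X 1 ∈ RingHom.ker φ₂ := by simp [RingHom.mem_ker, φ₂]
      rw [← h, RingHom.mem_ker] at this
      simp [φ₁] at this
  have l2 : RingHom.ker φ₂ < RingHom.ker (MvPolynomial.eval (0 : Fin 3 → ℂ)) := by
    refine lt_of_le_of_ne (fun x hx => ?_) fun h => ?_
    · rw [RingHom.mem_ker] at hx ⊢
      rw [← h32, RingHom.comp_apply, hx, map_zero]
    · have : MvPolynomial.X 2 ∈ RingHom.ker (MvPolynomial.eval (0 : Fin 3 → ℂ)) := by
        simp [RingHom.mem_ker]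
      rw [← h, RingHom.mem_ker] at this
      simp [φ₂] at this
  have := RingHom.ker_isPrime φ₁
  have := RingHom.ker_isPrime φ₂
  have := RingHom.ker_isPrime (MvPolynomial.eval (0 : Fin 3 → ℂ))
  have e0 := Ideal.height_add_one_le_of_lt_of_isPrime l0
  have e1 := Ideal.height_add_one_le_of_lt_of_isPrime l1
  have e2 := Ideal.height_add_one_le_of_lt_of_isPrime l2
  refine le_trans ?_ ((add_le_add_left ((add_le_add_left e0 1).trans e1) 1).trans e2)
  rw [Ideal.height_bot]
  norm_num

/-- Two polynomials in three variables that vanish at the origin have another common zero. -/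
theorem exists_common_zero (F G : MvPolynomial (Fin 3) ℂ)
    (hF : MvPolynomial.eval 0 F = 0) (hG : MvPolynomial.eval 0 G = 0) :
    ∃ x : Fin 3 → ℂ, x ≠ 0 ∧ MvPolynomial.eval x F = 0 ∧ MvPolynomial.eval x G = 0 := by
  -- If the origin were the only common zero, the Nullstellensatz would make its maximal ideal the
  -- radical of (F, G). It would be minimal over two generators, so of height at most two by Krull.
  by_contra! hcon
  have hz : MvPolynomial.zeroLocus ℂ (Ideal.span {F, G}) = {0} := by
    ext x
    rw [MvPolynomial.zeroLocus_span]
    simp only [Set.mem_insert_iff, Set.mem_singleton_iff, forall_eq_or_imp, forall_eq,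
      Set.mem_ofPred_eq, MvPolynomial.aeval_eq_eval]
    constructor
    · rintro ⟨h1, h2⟩
      by_contra hx
      exact hcon x hx h1 h2
    · rintro rfl
      exact ⟨hF, hG⟩
  have hrad : (Ideal.span {F, G}).radical = RingHom.ker (MvPolynomial.eval (0 : Fin 3 → ℂ)) := by
    rw [← MvPolynomial.vanishingIdeal_zeroLocus_eq_radical (K := ℂ), hz]
    ext x
    simp [RingHom.mem_ker,
      MvPolynomial.aeval_eq_eval]
  have hprime : (RingHom.ker (MvPolynomial.eval (0 : Fin 3 → ℂ))).IsPrime :=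
    RingHom.ker_isPrime _
  have hmin : RingHom.ker (MvPolynomial.eval (0 : Fin 3 → ℂ)) ∈
      (Ideal.span {F, G}).minimalPrimes := by
    rw [← Ideal.radical_minimalPrimes, hrad, Ideal.minimalPrimes_eq_subsingleton_self]
    rfl
  have h2 := Ideal.height_le_card_of_mem_minimalPrimes_span (Set.toFinite _) hmin
  have h3 := three_le_height_ker_eval_zero.trans
    (h2.trans (Nat.cast_le.2 (Set.ncard_insert_le F {G})))
  rw [Set.ncard_singleton] at h3
  exact absurd h3 (by norm_num)


/-! ### Flexes of a smooth plane cubic -/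

section TernaryCubic

variable {E : Type*} [AddCommGroup E] [Module ℂ E]

/-- A trilinear form is symmetric. -/
structure IsSymmTrilinear (T : E →ₗ[ℂ] E →ₗ[ℂ] E →ₗ[ℂ] ℂ) : Prop where
  swap_left : ∀ x y z, T x y z = T y x z
  swap_right : ∀ x y z, T x y z = T x z y

/-- The cubic `T x x x = 0` is smooth. -/
def IsSmoothTrilinear (T : E →ₗ[ℂ] E →ₗ[ℂ] E →ₗ[ℂ] ℂ) : Prop :=
  ∀ x, x ≠ 0 → T x x x = 0 → ∃ y, T x x y ≠ 0

/-- The vector `a` lies on the cubic `T x x x = 0` and on its Hessian. -/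
def IsFlexVector (T : E →ₗ[ℂ] E →ₗ[ℂ] E →ₗ[ℂ] ℂ) (a : E) : Prop :=
  T a a a = 0 ∧ ∃ w, w ≠ 0 ∧ ∀ u, T a w u = 0

variable {T : E →ₗ[ℂ] E →ₗ[ℂ] E →ₗ[ℂ] ℂ}

theorem IsFlexVector.smul {a : E} (h : IsFlexVector T a) (c : ℂ) : IsFlexVector T (c • a) := by
  obtain ⟨h0, w, hw, h1⟩ := h
  exact ⟨by simp [h0], w, hw, fun u => by simp [h1]⟩

theorem isFlexVector_smul_iff {a : E} {c : ℂ} (hc : c ≠ 0) :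
    IsFlexVector T (c • a) ↔ IsFlexVector T a :=
  ⟨fun h => by simpa [smul_smul, hc] using h.smul c⁻¹, fun h => h.smul c⟩

theorem isFlexVector_rep_mk_iff {a : E} (ha : a ≠ 0) :
    IsFlexVector T (Projectivization.mk ℂ a ha).rep ↔ IsFlexVector T a := by
  obtain ⟨c, hc⟩ := Projectivization.exists_smul_eq_mk_rep ℂ a ha
  rw [← hc, Units.smul_def, isFlexVector_smul_iff c.ne_zero]

/-- A bilinear form is degenerate exactly when its Gram determinant vanishes. -/
theorem exists_left_kernel_iff_det_eq_zero {n : Type*} [Fintype n] [DecidableEq n]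
    (b : Module.Basis n ℂ E) (B : E →ₗ[ℂ] E →ₗ[ℂ] ℂ) (hB : ∀ x y, B x y = B y x) :
    (∃ w, w ≠ 0 ∧ ∀ u, B w u = 0) ↔ (Matrix.of fun i j => B (b i) (b j)).det = 0 := by
  rw [← Matrix.exists_mulVec_eq_zero_iff]
  have key (x : n → ℂ) (i : n) : ((Matrix.of fun i j => B (b i) (b j)).mulVec x) i =
      B (b.equivFun.symm x) (b i) := by
    simp only [Matrix.mulVec, dotProduct, Matrix.of_apply, Module.Basis.equivFun_symm_apply,
      map_sum, map_smul, LinearMap.sum_apply, LinearMap.smul_apply, smul_eq_mul]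
    exact Finset.sum_congr rfl fun j _ => by rw [hB, mul_comm]
  constructor
  · rintro ⟨w, hw, h⟩
    refine ⟨b.equivFun w, by simpa using hw, ?_⟩
    ext i
    rw [key]
    simp [h]
  · rintro ⟨x, hx, h⟩
    refine ⟨b.equivFun.symm x, b.equivFun.symm.map_ne_zero_iff.2 hx, fun u => ?_⟩
    have : B (b.equivFun.symm x) = 0 := b.ext fun i => by rw [← key, h]; rfl
    rw [this, LinearMap.zero_apply]

/-- A plane cubic meets its Hessian. -/
theorem exists_isFlexVector (hT : IsSymmTrilinear T) (b : Module.Basis (Fin 3) ℂ E) :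
    ∃ a, a ≠ 0 ∧ IsFlexVector T a := by
  let F : MvPolynomial (Fin 3) ℂ := ∑ i, ∑ j, ∑ k, MvPolynomial.C (T (b i) (b j) (b k)) *
    MvPolynomial.X i * MvPolynomial.X j * MvPolynomial.X k
  let M : Matrix (Fin 3) (Fin 3) (MvPolynomial (Fin 3) ℂ) := Matrix.of fun i j =>
    ∑ k, MvPolynomial.C (T (b k) (b i) (b j)) * MvPolynomial.X k
  have hFe (x : Fin 3 → ℂ) : MvPolynomial.eval x F =
      T (b.equivFun.symm x) (b.equivFun.symm x) (b.equivFun.symm x) := by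
    simp only [F, map_sum, map_mul, MvPolynomial.eval_C, MvPolynomial.eval_X,
      Module.Basis.equivFun_symm_apply, map_smul, LinearMap.sum_apply, LinearMap.smul_apply,
      smul_eq_mul, Finset.mul_sum]
    refine Finset.sum_comm.trans ?_
    rw [Finset.sum_comm]
    simp only [Fin.sum_univ_three]
    ring
  have hMe (x : Fin 3 → ℂ) : MvPolynomial.eval x M.det =
      (Matrix.of fun i j => T (b.equivFun.symm x) (b i) (b j)).det := by
    rw [RingHom.map_det]
    congr 1
    ext i j
    simp [M, Module.Basis.equivFun_symm_apply, mul_comm]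
  -- The Hessian determinant vanishes at the origin because `T 0 = 0` is degenerate; any nonzero
  -- vector, here `b 0`, lies in its kernel.
  obtain ⟨x, hx, h1, h2⟩ := exists_common_zero F M.det (by rw [hFe]; simp)
    (by rw [hMe]; exact (exists_left_kernel_iff_det_eq_zero b (T (b.equivFun.symm 0))
      (hT.swap_right _)).1 ⟨b 0, b.ne_zero 0, by simp⟩)
  rw [hFe] at h1
  rw [hMe] at h2
  exact ⟨b.equivFun.symm x, b.equivFun.symm.map_ne_zero_iff.2 hx, h1,
    (exists_left_kernel_iff_det_eq_zero b _ (hT.swap_right _)).2 h2⟩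

/-- A flex `a`, a point `b` on its tangent line annihilated by the Hessian, and a point off the
tangent line form a basis. -/
theorem exists_basis_of_flex (hT : IsSymmTrilinear T) (hE : Module.finrank ℂ E = 3) {a b c : E}
    (h0 : T a a a = 0) (hb : b ≠ 0) (hab : ∀ u, T a b u = 0) (hc : T a a c ≠ 0) :
    ∃ e : Module.Basis (Fin 3) ℂ E, e 0 = a ∧ e 1 = b ∧ e 2 = c := by
  have : FiniteDimensional ℂ E := FiniteDimensional.of_finrank_pos (by omega)
  have haab : T a a b = 0 := by rw [hT.swap_right, hab]
  have hli : LinearIndependent ℂ ![a, b, c] := by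
    rw [Fintype.linearIndependent_iff]
    intro g hg
    simp only [Fin.sum_univ_three, Matrix.cons_val] at hg
    -- The functional `T a a` kills a and b but not c; then T(a, ·, c) kills b but not a.
    have h2 : g 2 = 0 := by
      have := congrArg (T a a) hg
      simpa [h0, haab, hc] using this
    have h3 : g 0 = 0 := by
      have := congrArg (fun v => T a v c) hg
      simpa [h2, hab, hc] using this
    have h4 : g 1 = 0 := by simpa [h2, h3, hb] using hg
    intro i
    fin_cases i <;> assumption
  refine ⟨basisOfLinearIndependentOfCardEqFinrank hli (by simp [hE]), ?_, ?_, ?_⟩ <;> simp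

/-- In the basis a, b, c the functional `T a a` is a nonzero multiple of the third coordinate, so
its kernel, the tangent line at a, is spanned by a and b. -/
theorem exists_eq_add_of_flex (hT : IsSymmTrilinear T) (hs : IsSmoothTrilinear T)
    (hE : Module.finrank ℂ E = 3) {a b : E} (ha : a ≠ 0) (h0 : T a a a = 0) (hb : b ≠ 0)
    (hab : ∀ u, T a b u = 0) {u : E} (hu : T a a u = 0) : ∃ s t : ℂ, u = s • a + t • b := by
  obtain ⟨c, hc⟩ := hs a ha h0
  have haab : T a a b = 0 := by rw [hT.swap_right, hab]
  obtain ⟨e, he0, he1, he2⟩ := exists_basis_of_flex hT hE h0 hb hab hc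
  have hexp : u = e.repr u 0 • a + e.repr u 1 • b + e.repr u 2 • c := by
    conv_lhs => rw [← e.sum_repr u, Fin.sum_univ_three, he0, he1, he2]
  have h2 : e.repr u 2 = 0 := by
    rw [hexp] at hu
    simpa [h0, haab, hc] using hu
  exact ⟨_, _, by rw [h2, zero_smul, add_zero] at hexp; exact hexp⟩

/-- A smooth plane cubic contains no inflectional tangent. -/
theorem apply_self_ne_zero_of_flex (hT : IsSymmTrilinear T) (hs : IsSmoothTrilinear T)
    (hE : Module.finrank ℂ E = 3) {a b : E} (ha : a ≠ 0) (h0 : T a a a = 0) (hb : b ≠ 0)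
    (hab : ∀ u, T a b u = 0) : T b b b ≠ 0 := by
  obtain ⟨c, hc⟩ := hs a ha h0
  have haab : T a a b = 0 := by rw [hT.swap_right, hab]
  intro hbbb
  obtain ⟨e, he0, he1, he2⟩ := exists_basis_of_flex hT hE h0 hb hab hc
  -- If b were on the cubic, so would be the whole line ab. At t•a + b the differential vanishes on
  -- a and b, and on c it is t² T(a, a, c) + T(b, b, c), which this t annihilates: a singular point.
  obtain ⟨t, ht⟩ := IsAlgClosed.exists_pow_nat_eq (-(T b b c) / T a a c) (n := 2) (by norm_num)
  have ht' : t ^ 2 * T a a c + T b b c = 0 := by rw [ht]; field_simp; ring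
  have hba : ∀ u, T b a u = 0 := fun u => by rw [hT.swap_left, hab]
  have hbba : T b b a = 0 := by rw [hT.swap_right, hba]
  have hne : t • a + b ≠ 0 := by
    intro h
    have h1 := congrArg (fun v => T a v c) h
    have h2 : t = 0 := by simpa [hab, hc] using h1
    exact hb (by simpa [h2] using h)
  obtain ⟨y, hy⟩ := hs _ hne (by simp [h0, hbbb, hab, hba, hbba, haab])
  refine hy ?_
  have : T (t • a + b) (t • a + b) = 0 := e.ext fun i => by
    fin_cases i
    · simp [he0, h0, hab, hba, hbba]
    · simp [he1, haab, hab, hba, hbbb]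
    · simp only [Fin.reduceFinMk, he2]
      simp only [map_add, map_smul, LinearMap.add_apply, LinearMap.smul_apply, smul_eq_mul,
        hab, hba, LinearMap.zero_apply]
      linear_combination ht'
  rw [this, LinearMap.zero_apply]

/-- A point at which the tangent line meets a smooth plane cubic with multiplicity three lies on
the Hessian. -/
theorem isFlexVector_of_forall (hT : IsSymmTrilinear T) (hs : IsSmoothTrilinear T)
    (hE : Module.finrank ℂ E = 3) {a : E} (ha : a ≠ 0) (h0 : T a a a = 0)
    (h : ∀ w, T a a w = 0 → T a w w = 0) : IsFlexVector T a := by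
  have : FiniteDimensional ℂ E := FiniteDimensional.of_finrank_pos (by omega)
  obtain ⟨c, hc⟩ := hs a ha h0
  have hrange : Module.finrank ℂ (LinearMap.range (T a a)) ≤ 1 :=
    (Submodule.finrank_le _).trans_eq (Module.finrank_self ℂ)
  have hker := (T a a).finrank_range_add_finrank_ker
  obtain ⟨w, hw, hwa⟩ : ∃ w ∈ LinearMap.ker (T a a), w ∉ Submodule.span ℂ {a} := by
    by_contra! hcon
    have := Submodule.finrank_mono (show LinearMap.ker (T a a) ≤ _ from hcon)
    rw [finrank_span_singleton ha] at this
    omega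
  rw [LinearMap.mem_ker] at hw
  have hker0 (u : E) (hu : T a a u = 0) : T a w u = 0 := by
    have h1 := h (w + u) (by rw [map_add, hw, hu, add_zero])
    simp only [map_add, LinearMap.add_apply, h w hw, h u hu, hT.swap_right a u w] at h1
    linear_combination (1 / 2 : ℂ) * h1
  -- `T a w` vanishes on the kernel of `T a a`, so it is a multiple of `T a a`; subtracting that
  -- multiple of a from w puts the difference in the kernel of `T a`. It is nonzero since w is not a
  -- multiple of a.
  refine ⟨h0, w - (T a w c / T a a c) • a, fun hwa' => hwa ?_, fun u => ?_⟩
  · rw [sub_eq_zero.1 hwa']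
    exact Submodule.smul_mem _ _ (Submodule.mem_span_singleton_self a)
  · have h1 := hker0 (u - (T a a u / T a a c) • c) (by simp [hc])
    simp only [map_sub, map_smul, LinearMap.sub_apply, LinearMap.smul_apply, smul_eq_mul] at h1 ⊢
    linear_combination h1

/-- A smooth plane cubic has an equation `y³ + 3x²z + 3pyz² + qz³ = 0`. -/
theorem exists_weierstrass_basis (hT : IsSymmTrilinear T) (hs : IsSmoothTrilinear T)
    (hE : Module.finrank ℂ E = 3) :
    ∃ e : Module.Basis (Fin 3) ℂ E, T (e 0) (e 0) (e 0) = 0 ∧ T (e 0) (e 0) (e 1) = 0 ∧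
      T (e 0) (e 0) (e 2) = 1 ∧ T (e 0) (e 1) (e 1) = 0 ∧ T (e 0) (e 1) (e 2) = 0 ∧
      T (e 0) (e 2) (e 2) = 0 ∧ T (e 1) (e 1) (e 1) = 1 ∧ T (e 1) (e 1) (e 2) = 0 := by
  have : FiniteDimensional ℂ E := FiniteDimensional.of_finrank_pos (by omega)
  obtain ⟨a, ha, h0, b, hb, hab⟩ :=
    exists_isFlexVector hT (Module.finBasisOfFinrankEq ℂ E hE)
  obtain ⟨c, hc⟩ := hs a ha h0
  have hbbb : T b b b ≠ 0 := apply_self_ne_zero_of_flex hT hs hE ha h0 hb hab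
  obtain ⟨k, hk⟩ := IsAlgClosed.exists_pow_nat_eq (T b b b)⁻¹ (n := 3) (by norm_num)
  have hk0 : k ≠ 0 := by
    rintro rfl
    exact inv_ne_zero hbbb (by rw [← hk]; norm_num)
  set b' := k • b with hb'
  have hab' : ∀ u, T a b' u = 0 := fun u => by simp [hb', hab]
  have hba' : ∀ u, T b' a u = 0 := fun u => by rw [hT.swap_left, hab']
  have haab' : T a a b' = 0 := by rw [hT.swap_right, hab']
  have hbba' : T b' b' a = 0 := by rw [hT.swap_right, hba']
  have hbbb' : T b' b' b' = 1 := by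
    simp only [hb', map_smul, LinearMap.smul_apply, smul_eq_mul]
    calc _ = k ^ 3 * T b b b := by ring
      _ = 1 := by rw [hk, inv_mul_cancel₀ hbbb]
  set d := (T a a c)⁻¹ • c with hd
  have hd1 : T a a d = 1 := by simp [hd, hc]
  -- The multiple of a is chosen to make T(a, d', d') vanish, and the multiple of b' to make T(b',
  -- b', d') vanish; neither changes T(a, a, d) = 1.
  set d' := d + (-(T a d d) / 2) • a + (-(T b' b' d)) • b' with hd'
  obtain ⟨e, he0, he1, he2⟩ := exists_basis_of_flex (b := b') (c := d') hT hE h0 (smul_ne_zero hk0 hb) hab'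
    (by simp [hd', h0, haab', hd1])
  have hada : T a d a = 1 := by rw [hT.swap_right, hd1]
  have hadb : T a d b' = 0 := by rw [hT.swap_right, hab']
  refine ⟨e, ?_⟩
  rw [he0, he1, he2]
  refine ⟨h0, haab', by simp [hd', h0, haab', hd1], hab' _, hab' _, ?_, hbbb', ?_⟩
  · simp only [hd', map_add, map_smul, LinearMap.add_apply, LinearMap.smul_apply, smul_eq_mul,
      h0, hab', haab', hd1, hada, hadb]
    ring
  · simp only [hd', map_add, map_smul, smul_eq_mul, hbba', hbbb']
    ring

/-- The affine flexes of `y³ + 3x² + 3py + q = 0`. -/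
theorem ncard_affine_flexes (p q : ℂ)
    (hs : ∀ y : ℂ, y ^ 3 + 3 * p * y + q = 0 → y ^ 2 + p ≠ 0) :
    {s : ℂ × ℂ | s.2 ^ 3 + 3 * s.1 ^ 2 + 3 * p * s.2 + q = 0 ∧
      p * s.2 ^ 2 + q * s.2 - p ^ 2 - s.1 ^ 2 * s.2 = 0}.ncard = 8 := by
  classical
  -- Eliminating x² between the two equations leaves this quartic in y, the 3-division polynomial of
  -- the curve up to scaling.
  let ψ : Polynomial ℂ := .X ^ 4 + .C (6 * p) * .X ^ 2 + .C (4 * q) * .X - .C (3 * p ^ 2)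
  have hdeg : ψ.natDegree = 4 := by simp only [ψ]; compute_degree!
  have hψ0 : ψ ≠ 0 := by
    intro h
    simp [h] at hdeg
  have hroot (y : ℂ) : y ∈ ψ.roots ↔ y ^ 4 + 6 * p * y ^ 2 + 4 * q * y - 3 * p ^ 2 = 0 := by
    rw [Polynomial.mem_roots hψ0]
    simp [ψ, Polynomial.IsRoot]
  -- A root of ψ has x ≠ 0: a common root with the cubic in y would have y² + p = 0, which `hs`
  -- excludes.
  have hsimple (y : ℂ) (hy : y ^ 4 + 6 * p * y ^ 2 + 4 * q * y - 3 * p ^ 2 = 0) :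
      y ^ 3 + 3 * p * y + q ≠ 0 := by
    intro h
    refine hs y h ?_
    have h2 : (y ^ 2 + p) ^ 2 = 0 := by linear_combination (-(1 / 3) : ℂ) * hy + 4 / 3 * y * h
    exact pow_eq_zero_iff (two_ne_zero) |>.1 h2
  have hnodup : ψ.roots.Nodup := by
    rw [Multiset.nodup_iff_count_le_one]
    intro y
    rw [Polynomial.count_roots]
    by_contra! hlt
    obtain ⟨h1, h2⟩ := (Polynomial.one_lt_rootMultiplicity_iff_isRoot hψ0).1 hlt
    have h1' := (hroot y).1 ((Polynomial.mem_roots hψ0).2 h1)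
    refine hsimple y h1' ?_
    -- The derivative of ψ is four times the cubic in y, so a multiple root of ψ would be a root of
    -- that cubic.
    have h3 : 4 * y ^ 3 + 6 * p * (2 * y) + 4 * q = 0 := by
      simpa [ψ, Polynomial.IsRoot, one_add_one_eq_two, ← Polynomial.C_pow, -map_pow,
        show (3 : ℂ) + 1 = 4 by norm_num] using h2
    linear_combination (1 / 4 : ℂ) * h3
  have hcard : ψ.roots.toFinset.card = 4 := by
    rw [Multiset.toFinset_card_of_nodup hnodup, ← hdeg]
    exact (IsAlgClosed.splits ψ).natDegree_eq_card_roots.symm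
  -- Over each of the four roots y lie the two points x = ± r y, distinct because r y ≠ 0.
  choose r hr using fun y : ℂ =>
    IsAlgClosed.exists_pow_nat_eq (-(y ^ 3 + 3 * p * y + q) / 3) (n := 2) (by norm_num)
  have himage : {s : ℂ × ℂ | s.2 ^ 3 + 3 * s.1 ^ 2 + 3 * p * s.2 + q = 0 ∧
      p * s.2 ^ 2 + q * s.2 - p ^ 2 - s.1 ^ 2 * s.2 = 0} =
      ((ψ.roots.toFinset ×ˢ ({1, -1} : Finset ℂ)).image fun t => (t.2 * r t.1, t.1) :
        Finset (ℂ × ℂ)) := by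
    ext ⟨x, y⟩
    simp only [Set.mem_ofPred_eq, Finset.coe_image, Finset.coe_product, Set.mem_image,
      Set.mem_prod, Finset.mem_coe, Multiset.mem_toFinset, hroot, Finset.mem_insert,
      Finset.mem_singleton, Prod.exists, Prod.mk.injEq]
    constructor
    · rintro ⟨h1, h2⟩
      have hx : x ^ 2 = r y ^ 2 := by rw [hr]; linear_combination (1 / 3 : ℂ) * h1
      have hy : y ^ 4 + 6 * p * y ^ 2 + 4 * q * y - 3 * p ^ 2 = 0 := by
        linear_combination y * h1 + 3 * h2
      rcases sq_eq_sq_iff_eq_or_eq_neg.1 hx with h | h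
      · exact ⟨y, 1, ⟨hy, Or.inl rfl⟩, by simp [h], rfl⟩
      · exact ⟨y, -1, ⟨hy, Or.inr rfl⟩, by simp [h], rfl⟩
    · rintro ⟨y', ε, ⟨hy, hε⟩, rfl, rfl⟩
      have hε2 : ε ^ 2 = 1 := by rcases hε with rfl | rfl <;> norm_num
      have hx : (ε * r y') ^ 2 = -(y' ^ 3 + 3 * p * y' + q) / 3 := by
        rw [mul_pow, hε2, hr, one_mul]
      rw [hx]
      constructor
      · ring
      · linear_combination (1 / 3 : ℂ) * hy
  rw [himage, Set.ncard_coe_finset, Finset.card_image_of_injOn, Finset.card_product, hcard,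
    Finset.card_pair (by norm_num)]
  rintro ⟨y, ε⟩ h ⟨y', ε'⟩ - heq
  simp only [Finset.coe_product, Set.mem_prod, Finset.mem_coe, Multiset.mem_toFinset, hroot] at h
  simp only [Prod.mk.injEq] at heq
  obtain ⟨h1, rfl⟩ := heq
  have hr0 : r y ≠ 0 := by
    intro h0
    refine hsimple y h.1 ?_
    have := hr y
    rw [h0] at this
    linear_combination (3 : ℂ) * this
  rw [mul_right_cancel₀ hr0 h1]

/-- A smooth plane cubic has exactly nine flexes. -/
theorem ncard_isFlexVector (hT : IsSymmTrilinear T) (hs : IsSmoothTrilinear T)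
    (hE : Module.finrank ℂ E = 3) : {a : ℙ ℂ E | IsFlexVector T a.rep}.ncard = 9 := by
  obtain ⟨e, h000, h001, h002, h011, h012, h022, h111, h112⟩ := exists_weierstrass_basis hT hs hE
  set p := T (e 1) (e 2) (e 2) with hp
  set q := T (e 2) (e 2) (e 2) with hq
  have h010 : T (e 0) (e 1) (e 0) = 0 := by rw [hT.swap_right, h001]
  have h020 : T (e 0) (e 2) (e 0) = 1 := by rw [hT.swap_right, h002]
  have h021 : T (e 0) (e 2) (e 1) = 0 := by rw [hT.swap_right, h012]
  have h121 : T (e 1) (e 2) (e 1) = 0 := by rw [hT.swap_right, h112]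
  have h10 u : T (e 1) (e 0) u = T (e 0) (e 1) u := hT.swap_left _ _ _
  have h20 u : T (e 2) (e 0) u = T (e 0) (e 2) u := hT.swap_left _ _ _
  have h21 u : T (e 2) (e 1) u = T (e 1) (e 2) u := hT.swap_left _ _ _
  have h110 : T (e 1) (e 1) (e 0) = 0 := by rw [hT.swap_right, h10, h011]
  have h120 : T (e 1) (e 2) (e 0) = 0 := by rw [hT.swap_right, h10, h012]
  have h220 : T (e 2) (e 2) (e 0) = 0 := by rw [hT.swap_right, h20, h022]
  have h221 : T (e 2) (e 2) (e 1) = p := by rw [hT.swap_right, h21]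
  have hflex (x y z : ℂ) : IsFlexVector T (x • e 0 + y • e 1 + z • e 2) ↔
      y ^ 3 + 3 * x ^ 2 * z + 3 * p * y * z ^ 2 + q * z ^ 3 = 0 ∧
      z * (y * (p * y + q * z) - p ^ 2 * z ^ 2) - x ^ 2 * y = 0 := by
    refine and_congr ?_ ?_
    · simp only [map_add, map_smul, LinearMap.add_apply, LinearMap.smul_apply, smul_eq_mul, h10,
        h20, h21, h000, h001, h002, h010, h011, h012, h020, h021, h022, h110, h111, h112, h120,
        h121, h220, h221, ← hp, ← hq]
      ring_nf
    · rw [exists_left_kernel_iff_det_eq_zero e _ (hT.swap_right _), Matrix.det_fin_three]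
      simp only [Matrix.of_apply, map_add, map_smul, LinearMap.add_apply, LinearMap.smul_apply,
        smul_eq_mul, h10, h20, h21, h000, h001, h002, h010, h011, h012, h020, h021, h022, h110,
        h111, h112, h120, h121, h220, h221, ← hp, ← hq]
      ring_nf
  have hexp (v : E) : v = e.repr v 0 • e 0 + e.repr v 1 • e 1 + e.repr v 2 • e 2 := by
    conv_lhs => rw [← e.sum_repr v, Fin.sum_univ_three]
  have hcoord (x y z x' y' z' : ℂ) (h : x • e 0 + y • e 1 + z • e 2 =
      x' • e 0 + y' • e 1 + z' • e 2) : x = x' ∧ y = y' ∧ z = z' := by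
    have h0 := congrArg (fun v => e.repr v 0) h
    have h1 := congrArg (fun v => e.repr v 1) h
    have h2 := congrArg (fun v => e.repr v 2) h
    simp at h0 h1 h2
    exact ⟨h0, h1, h2⟩
  have hne (x y : ℂ) : x • e 0 + y • e 1 + e 2 ≠ 0 := fun h => by
    have := hcoord x y 1 0 0 0 (by simpa using h)
    exact one_ne_zero this.2.2
  let m : ℂ × ℂ → ℙ ℂ E := fun s => Projectivization.mk ℂ (s.1 • e 0 + s.2 • e 1 + e 2) (hne _ _)
  have hm : Function.Injective m := by
    rintro ⟨x, y⟩ ⟨x', y'⟩ h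
    obtain ⟨t, ht⟩ := (Projectivization.mk_eq_mk_iff' ℂ _ _ _ _).1 h
    simp only [smul_add, smul_smul] at ht
    obtain ⟨h0, h1, h2⟩ := hcoord (t * x') (t * y') t x y 1 (by rw [one_smul]; exact ht)
    subst h2
    simp [← h0, ← h1]
  have hnot (s : ℂ × ℂ) : m s ≠ Projectivization.mk ℂ (e 0) (e.ne_zero 0) := by
    intro h
    obtain ⟨t, ht⟩ := (Projectivization.mk_eq_mk_iff' ℂ _ _ _ _).1 h
    have := hcoord t 0 0 s.1 s.2 1 (by simpa using ht)
    exact zero_ne_one this.2.2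
  have hset : {a : ℙ ℂ E | IsFlexVector T a.rep} =
      insert (Projectivization.mk ℂ (e 0) (e.ne_zero 0))
        (m '' {s : ℂ × ℂ | s.2 ^ 3 + 3 * s.1 ^ 2 + 3 * p * s.2 + q = 0 ∧
          p * s.2 ^ 2 + q * s.2 - p ^ 2 - s.1 ^ 2 * s.2 = 0}) := by
    ext A
    induction A with | h v hv =>
    simp only [Set.mem_ofPred_eq, isFlexVector_rep_mk_iff, Set.mem_insert_iff, Set.mem_image]
    constructor
    · intro hfl
      have hv' := hexp v
      generalize e.repr v 0 = x at hv'
      generalize e.repr v 1 = y at hv'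
      generalize e.repr v 2 = z at hv'
      subst hv'
      -- On the line z = 0 the equation reduces to y³ = 0, so the only flex there is `e 0`;
      -- elsewhere scale to z = 1.
      by_cases hz : z = 0
      · left
        subst hz
        obtain ⟨h1, h2⟩ := (hflex _ _ _).1 hfl
        have hy : y = 0 := pow_eq_zero_iff (three_ne_zero) |>.1 (by linear_combination h1)
        rw [Projectivization.mk_eq_mk_iff']
        exact ⟨x, by simp [hy]⟩
      · right
        have hvz : x • e 0 + y • e 1 + z • e 2 =
            z • ((x / z) • e 0 + (y / z) • e 1 + (1 : ℂ) • e 2) := by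
          simp only [smul_add, smul_smul, mul_div_cancel₀ _ hz, mul_one]
        rw [hvz, isFlexVector_smul_iff hz, hflex] at hfl
        refine ⟨(x / z, y / z), ⟨by linear_combination hfl.1, by linear_combination hfl.2⟩, ?_⟩
        rw [Projectivization.mk_eq_mk_iff']
        exact ⟨z⁻¹, by rw [hvz, smul_smul, inv_mul_cancel₀ hz]; simp⟩
    · rintro (h | ⟨s, ⟨h1, h2⟩, h⟩)
      · rw [← isFlexVector_rep_mk_iff hv, h, isFlexVector_rep_mk_iff]
        have := (hflex 1 0 0).2 (by norm_num)
        simpa using this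
      · rw [← isFlexVector_rep_mk_iff hv, ← h, isFlexVector_rep_mk_iff]
        have := (hflex s.1 s.2 1).2 ⟨by linear_combination h1, by linear_combination h2⟩
        simpa using this
  -- A y with y³ + 3py + q = 0 and y² + p = 0 would make (0 : y : 1) a singular point.
  have h8 := ncard_affine_flexes p q fun y hy hy' => by
    obtain ⟨w, hw⟩ := hs ((0 : ℂ) • e 0 + y • e 1 + (1 : ℂ) • e 2)
      (by simpa using hne 0 y) (by
        simp only [map_add, map_smul, LinearMap.add_apply, LinearMap.smul_apply, smul_eq_mul, h10,
          h20, h21, h000, h001, h002, h010, h011, h012, h020, h021, h022, h110, h111, h112, h120,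
          h121, h220, h221, ← hp, ← hq]
        linear_combination hy)
    refine hw ?_
    have : T ((0 : ℂ) • e 0 + y • e 1 + (1 : ℂ) • e 2)
        ((0 : ℂ) • e 0 + y • e 1 + (1 : ℂ) • e 2) = 0 := e.ext fun i => by
      fin_cases i
      all_goals
        simp only [Fin.zero_eta, Fin.mk_one, Fin.reduceFinMk, map_add, map_smul,
          LinearMap.add_apply, LinearMap.smul_apply, smul_eq_mul, h10,
          h20, h21, h000, h001, h002, h010, h011, h012, h020, h021, h022, h110, h111, h112, h120,
          h121, h220, h221, ← hp, ← hq, LinearMap.zero_apply]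
      · ring
      · linear_combination hy'
      · linear_combination hy - y * hy'
    rw [this, LinearMap.zero_apply]
  have hnotMem : Projectivization.mk ℂ (e 0) (e.ne_zero 0) ∉
      m '' {s : ℂ × ℂ | s.2 ^ 3 + 3 * s.1 ^ 2 + 3 * p * s.2 + q = 0 ∧
        p * s.2 ^ 2 + q * s.2 - p ^ 2 - s.1 ^ 2 * s.2 = 0} := fun ⟨s, _, h⟩ => hnot s h
  rw [hset, Set.ncard_insert_of_notMem hnotMem
    ((Set.finite_of_ncard_ne_zero (by rw [h8]; norm_num)).image _),
    Set.ncard_image_of_injective _ hm, h8]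

end TernaryCubic


/-! ### The symmetric trilinear form of a cubic form -/

section Polarization

/-- The commutator of two derivations is a derivation, and this one kills the variables. -/
theorem pderiv_comm {σ : Type*} (i j : σ) (f : MvPolynomial σ ℂ) :
    MvPolynomial.pderiv i (MvPolynomial.pderiv j f) =
      MvPolynomial.pderiv j (MvPolynomial.pderiv i f) := by
  classical
  have h : ⁅MvPolynomial.pderiv (R := ℂ) i, MvPolynomial.pderiv j⁆ = 0 :=
    MvPolynomial.derivation_ext fun k => by
      rw [Derivation.commutator_apply, MvPolynomial.pderiv_X, MvPolynomial.pderiv_X]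
      simp [Pi.single_apply, apply_ite]
  have h1 := congrArg (fun D => D f) h
  simpa [Derivation.commutator_apply, sub_eq_zero] using h1

/-- `T` is the symmetric trilinear form with `T x x x = f x`. -/
structure IsPolarization (f : MvPolynomial (Fin 5) ℂ) (T : V →ₗ[ℂ] V →ₗ[ℂ] V →ₗ[ℂ] ℂ) : Prop
    extends IsSymmTrilinear T where
  eval_eq : ∀ x, MvPolynomial.eval x f = T x x x
  sum_pderiv : ∀ x w, ∑ i, MvPolynomial.eval x (MvPolynomial.pderiv i f) * w i = 3 * T x x w

/-- The third partial derivatives of a cubic form are constants, and one sixth of them are the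
coefficients of T. Their symmetry is that of mixed partials, and Euler's identity in degrees 1, 2
and 3 recovers the second and first partials and f. -/
theorem exists_isPolarization {f : MvPolynomial (Fin 5) ℂ} (hf : f.IsHomogeneous 3) :
    ∃ T, IsPolarization f T := by
  let d (i j k : Fin 5) : ℂ := MvPolynomial.coeff 0
    (MvPolynomial.pderiv k (MvPolynomial.pderiv j (MvPolynomial.pderiv i f)))
  have hd (i j k : Fin 5) :
      MvPolynomial.pderiv k (MvPolynomial.pderiv j (MvPolynomial.pderiv i f)) =
        MvPolynomial.C (d i j k) := by
    have h := (hf.pderiv (i := i)).pderiv (i := j) |>.pderiv (i := k)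
    exact MvPolynomial.totalDegree_eq_zero_iff_eq_C.1
      ((MvPolynomial.totalDegree_zero_iff_isHomogeneous _).2 h)
  have hd1 (i j k : Fin 5) : d i j k = d j i k := by simp only [d, pderiv_comm j i]
  have hd2 (i j k : Fin 5) : d i j k = d i k j := by simp only [d, pderiv_comm k j]
  have e1 (x : V) : ∑ i, x i * MvPolynomial.eval x (MvPolynomial.pderiv i f) =
      3 * MvPolynomial.eval x f := by
    simpa using congrArg (MvPolynomial.eval x) hf.sum_X_mul_pderiv
  have e2 (x : V) (i : Fin 5) :
      ∑ j, x j * MvPolynomial.eval x (MvPolynomial.pderiv j (MvPolynomial.pderiv i f)) =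
        2 * MvPolynomial.eval x (MvPolynomial.pderiv i f) := by
    simpa using congrArg (MvPolynomial.eval x) (hf.pderiv (i := i)).sum_X_mul_pderiv
  have e3 (x : V) (i j : Fin 5) : ∑ k, x k * d i j k =
        MvPolynomial.eval x (MvPolynomial.pderiv j (MvPolynomial.pderiv i f)) := by
    simpa [hd] using congrArg (MvPolynomial.eval x)
      ((hf.pderiv (i := i)).pderiv (i := j)).sum_X_mul_pderiv
  let T : V →ₗ[ℂ] V →ₗ[ℂ] V →ₗ[ℂ] ℂ := ∑ i, ∑ j, ∑ k, (d i j k / 6) •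
    (LinearMap.proj i : V →ₗ[ℂ] ℂ).smulRight
      ((LinearMap.proj j : V →ₗ[ℂ] ℂ).smulRight (LinearMap.proj k : V →ₗ[ℂ] ℂ))
  have hTa (x y z : V) : T x y z = ∑ i, ∑ j, ∑ k, d i j k / 6 * (x i * (y j * z k)) := by
    simp [T, LinearMap.sum_apply]
  have hl (x y z : V) : T x y z = T y x z := by
    rw [hTa, hTa, Finset.sum_comm]
    refine Finset.sum_congr rfl fun i _ => Finset.sum_congr rfl fun j _ =>
      Finset.sum_congr rfl fun k _ => ?_
    rw [hd1]
    ring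
  have hr (x y z : V) : T x y z = T x z y := by
    rw [hTa, hTa]
    refine Finset.sum_congr rfl fun i _ => ?_
    rw [Finset.sum_comm]
    refine Finset.sum_congr rfl fun j _ => Finset.sum_congr rfl fun k _ => ?_
    rw [hd2]
    ring
  have hp (x w : V) :
      ∑ i, MvPolynomial.eval x (MvPolynomial.pderiv i f) * w i = 3 * T x x w := by
    rw [hr, hl, hTa, Finset.mul_sum]
    refine Finset.sum_congr rfl fun i _ => ?_
    have h := e2 x i
    simp only [← e3] at h
    have h' : ∑ j, ∑ k, d i j k / 6 * (w i * (x j * x k)) =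
        (∑ j, x j * ∑ k, x k * d i j k) * (w i / 6) := by
      simp only [Finset.mul_sum, Finset.sum_mul]
      exact Finset.sum_congr rfl fun j _ => Finset.sum_congr rfl fun k _ => by ring
    rw [h', h]
    ring
  refine ⟨T, ⟨hl, hr⟩, fun x => ?_, hp⟩
  have h := hp x x
  simp only [mul_comm _ (x _)] at h
  rw [e1] at h
  exact mul_left_cancel₀ three_ne_zero h

variable {f : MvPolynomial (Fin 5) ℂ} {T : V →ₗ[ℂ] V →ₗ[ℂ] V →ₗ[ℂ] ℂ}

theorem IsPolarization.alongLine_eq (h : IsPolarization f T) (v w : V) :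
    alongLine f v w = .C (T v v v) + .C (3 * T v v w) * .X + .C (3 * T v w w) * .X ^ 2 +
      .C (T w w w) * .X ^ 3 := by
  refine Polynomial.funext fun t => ?_
  have h1 : Polynomial.eval t (alongLine f v w) = MvPolynomial.eval (v + t • w) f := by
    rw [alongLine, ← Polynomial.coe_aeval_eq_eval, ← AlgHom.comp_apply, MvPolynomial.comp_aeval,
      ← MvPolynomial.aeval_eq_eval]
    congr 2
    ext i
    simp
    ring
  rw [h1, h.eval_eq]
  have s1 : T v w v = T v v w := h.swap_right _ _ _
  have s2 : T w v v = T v v w := by rw [h.swap_left, s1]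
  have s3 : T w v w = T v w w := h.swap_left _ _ _
  have s4 : T w w v = T v w w := by rw [h.swap_right, s3]
  simp only [map_add, map_smul, LinearMap.add_apply, LinearMap.smul_apply, smul_eq_mul, s1, s2, s3,
    s4, Polynomial.eval_add, Polynomial.eval_mul, Polynomial.eval_C, Polynomial.eval_X,
    Polynomial.eval_pow]
  ring

theorem IsPolarization.mem_zeroLocus (h : IsPolarization f T) {q : P4} :
    q ∈ zeroLocus f ↔ T q.rep q.rep q.rep = 0 := by
  rw [← h.eval_eq]
  rfl

theorem IsPolarization.mem_tangentSpace (h : IsPolarization f T) {q : P4} {w : V} :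
    w ∈ tangentSpace f q ↔ T q.rep q.rep w = 0 := by
  have h1 := h.sum_pderiv q.rep w
  simp only [tangentSpace, LinearMap.mem_ker, LinearMap.sum_apply, LinearMap.smul_apply,
    LinearMap.proj_apply, smul_eq_mul, h1, mul_eq_zero, OfNat.ofNat_ne_zero, false_or]

theorem IsPolarization.isSmoothTrilinear (h : IsPolarization f T) (hf : IsSmoothCubic f) :
    IsSmoothTrilinear T := by
  intro x hx h0
  obtain ⟨i, hi⟩ := hf.2 x hx (by rw [h.eval_eq, h0])
  refine ⟨Pi.single i 1, fun h1 => hi ?_⟩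
  have := h.sum_pderiv x (Pi.single i 1)
  simpa [h1, Pi.single_apply] using this

/-- Order at least three along a line means that the three lowest coefficients of f(q + tw) vanish.
-/
theorem IsPolarization.three_le_multiplicityIn (h : IsPolarization f T) {W : Submodule ℂ V}
    {q : P4} : 3 ≤ multiplicityIn f W q ↔ ∀ w ∈ W, T q.rep q.rep q.rep = 0 ∧
      T q.rep q.rep w = 0 ∧ T q.rep w w = 0 := by
  rw [multiplicityIn, le_iInf₂_iff]
  refine forall₂_congr fun w _ => ?_
  have : (3 : ℕ∞) = ((3 : ℕ) : ℕ∞) := rfl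
  rw [this, ← pow_dvd_iff_le_emultiplicity, Polynomial.X_pow_dvd_iff, h.alongLine_eq]
  constructor
  · intro hd
    have h0 := hd 0 (by norm_num)
    have h1 := hd 1 (by norm_num)
    have h2 := hd 2 (by norm_num)
    simp [-map_mul, Polynomial.coeff_X, Polynomial.coeff_C, Polynomial.coeff_X_pow] at h0 h1 h2
    exact ⟨h0, h1, h2⟩
  · rintro ⟨h0, h1, h2⟩ d hd
    interval_cases d <;> simp [h0, h1, h2]

theorem IsPolarization.multiplicityIn_le_three (h : IsPolarization f T) {W : Submodule ℂ V}
    {q : P4} {w : V} (hw : w ∈ W) (hw3 : T w w w ≠ 0) : multiplicityIn f W q ≤ 3 := by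
  refine (iInf₂_le w hw).trans ?_
  have : (3 : ℕ∞) = ((3 : ℕ) : ℕ∞) := rfl
  rw [this, ← not_lt, ← ENat.add_one_le_iff (ENat.natCast_ne_top 3), ← Nat.cast_one, ← Nat.cast_add,
    ← pow_dvd_iff_le_emultiplicity, Polynomial.X_pow_dvd_iff, h.alongLine_eq]
  intro hd
  have h3 := hd 3 (by norm_num)
  simp [-map_mul, Polynomial.coeff_X_pow] at h3
  exact hw3 h3

end Polarization


/-! ### Inflection points of a plane section as flexes of the restricted form -/

section PlaneSection

variable {f : MvPolynomial (Fin 5) ℂ} {T : V →ₗ[ℂ] V →ₗ[ℂ] V →ₗ[ℂ] ℂ}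

theorem submodule_le_iff {q : P4} {W : Submodule ℂ V} : q.submodule ≤ W ↔ q.rep ∈ W := by
  rw [Projectivization.submodule_eq, Submodule.span_singleton_le_iff_mem]

/-- The restriction of a trilinear form to a subspace. -/
def restrictTrilinear {E : Type*} [AddCommGroup E] [Module ℂ E]
    (T : E →ₗ[ℂ] E →ₗ[ℂ] E →ₗ[ℂ] ℂ) (H : Submodule ℂ E) : H →ₗ[ℂ] H →ₗ[ℂ] H →ₗ[ℂ] ℂ where
  toFun x := (T x).domRestrict₁₂ H H
  map_add' x y := by ext; simp [LinearMap.domRestrict₁₂_apply]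
  map_smul' c x := by ext; simp [LinearMap.domRestrict₁₂_apply]

@[simp]
theorem restrictTrilinear_apply {E : Type*} [AddCommGroup E] [Module ℂ E]
    (T : E →ₗ[ℂ] E →ₗ[ℂ] E →ₗ[ℂ] ℂ) (H : Submodule ℂ E) (x y z : H) :
    restrictTrilinear T H x y z = T x y z := rfl

theorem IsSymmTrilinear.restrict {E : Type*} [AddCommGroup E] [Module ℂ E]
    {T : E →ₗ[ℂ] E →ₗ[ℂ] E →ₗ[ℂ] ℂ} (hT : IsSymmTrilinear T) (H : Submodule ℂ E) :
    IsSymmTrilinear (restrictTrilinear T H) :=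
  ⟨fun _ _ _ => hT.swap_left _ _ _, fun _ _ _ => hT.swap_right _ _ _⟩

theorem IsPolarization.isSmoothSection_iff (h : IsPolarization f T) {H : Submodule ℂ V} :
    IsSmoothSection f H ↔ IsSmoothTrilinear (restrictTrilinear T H) := by
  constructor
  · intro hs x hx h0
    have hx' : (x : V) ≠ 0 := by simpa using hx
    obtain ⟨c, hc⟩ := Projectivization.exists_smul_eq_mk_rep ℂ (x : V) hx'
    rw [Units.smul_def] at hc
    have hmem : (Projectivization.mk ℂ (x : V) hx').rep ∈ H := by
      rw [← hc]
      exact H.smul_mem _ x.2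
    have h1 := hs (Projectivization.mk ℂ (x : V) hx')
      ⟨h.mem_zeroLocus.2 (by simpa [← hc] using h0), submodule_le_iff.2 hmem⟩
    obtain ⟨y, hy, hyt⟩ := SetLike.not_le_iff_exists.1 h1
    rw [h.mem_tangentSpace, ← hc] at hyt
    refine ⟨⟨y, hy⟩, fun h2 => hyt ?_⟩
    simp at h2
    simp [h2]
  · rintro hs a ⟨ha, haH⟩ hle
    rw [submodule_le_iff] at haH
    obtain ⟨y, hy⟩ := hs ⟨a.rep, haH⟩ (by simpa using a.rep_nonzero) (h.mem_zeroLocus.1 ha)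
    exact hy (h.mem_tangentSpace.1 (hle y.2))

/-- The multiplicity at `a` of the tangent line is at least three exactly at the flexes. -/
theorem IsPolarization.isFlexVector_iff (h : IsPolarization f T) {H : Submodule ℂ V}
    (hs : IsSmoothTrilinear (restrictTrilinear T H)) (hH : Module.finrank ℂ H = 3) {a : H}
    (ha : a ≠ 0) : IsFlexVector (restrictTrilinear T H) a ↔
      T a a a = 0 ∧ ∀ w ∈ H, T a a w = 0 → T a w w = 0 := by
  have hT := h.toIsSymmTrilinear.restrict H
  constructor
  · rintro ⟨h0, b, hb, hab⟩
    refine ⟨h0, fun w hw haw => ?_⟩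
    obtain ⟨s, t, hst⟩ := exists_eq_add_of_flex hT hs hH ha h0 hb hab (u := ⟨w, hw⟩) haw
    have hba : restrictTrilinear T H a b = 0 := LinearMap.ext hab
    have : restrictTrilinear T H a ⟨w, hw⟩ ⟨w, hw⟩ = s * restrictTrilinear T H a a ⟨w, hw⟩ := by
      conv_lhs => arg 1; rw [hst]
      rw [map_add, map_smul, map_smul, hba, smul_zero, add_zero, LinearMap.smul_apply,
        smul_eq_mul]
    refine this.trans ?_
    rw [restrictTrilinear_apply, haw, mul_zero]
  · rintro ⟨h0, h1⟩
    exact isFlexVector_of_forall hT hs hH ha h0 fun w hw => h1 w w.2 hw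

theorem IsPolarization.isInflectionPoint_iff (h : IsPolarization f T) {H : Submodule ℂ V}
    (hs : IsSmoothTrilinear (restrictTrilinear T H)) (hH : Module.finrank ℂ H = 3) {a : P4} :
    IsInflectionPoint f H a ↔ ∃ ha : a.rep ∈ H,
      IsFlexVector (restrictTrilinear T H) ⟨a.rep, ha⟩ := by
  have hT := h.toIsSymmTrilinear.restrict H
  constructor
  · rintro ⟨⟨h0, haH⟩, -, hm⟩
    rw [submodule_le_iff] at haH
    refine ⟨haH, (h.isFlexVector_iff hs hH (by simpa using a.rep_nonzero)).2
      ⟨h.mem_zeroLocus.1 h0, fun w hw haw => ?_⟩⟩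
    exact (h.three_le_multiplicityIn.1 hm.ge w ⟨hw, h.mem_tangentSpace.2 haw⟩).2.2
  · rintro ⟨haH, hfl⟩
    have ha0 : (⟨a.rep, haH⟩ : H) ≠ 0 := by simpa using a.rep_nonzero
    obtain ⟨h0, h1⟩ := (h.isFlexVector_iff hs hH ha0).1 hfl
    have hmem : a ∈ linearSection f H := ⟨h.mem_zeroLocus.2 h0, submodule_le_iff.2 haH⟩
    refine ⟨hmem, h.isSmoothSection_iff.2 hs a hmem, le_antisymm ?_ ?_⟩
    -- The tangent line is not contained in the curve: its point b has T(b, b, b) ≠ 0, which caps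
    -- the multiplicity at three.
    · obtain ⟨h0', b, hb, hab⟩ := hfl
      have hbbb := apply_self_ne_zero_of_flex hT hs hH ha0 h0' hb hab
      refine h.multiplicityIn_le_three (w := b) ⟨b.2, h.mem_tangentSpace.2 ?_⟩ hbbb
      rw [h.swap_right]
      exact hab ⟨a.rep, haH⟩
    · refine h.three_le_multiplicityIn.2 fun w hw => ?_
      have haw := h.mem_tangentSpace.1 hw.2
      exact ⟨h0, haw, h1 w hw.1 haw⟩

/-- The inclusion of H induces an injection of projective spaces that carries the flexes of the
restricted form onto the inflection points. -/
theorem IsPolarization.ncard_isInflectionPoint (h : IsPolarization f T) {H : Submodule ℂ V}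
    (hs : IsSmoothTrilinear (restrictTrilinear T H)) (hH : Module.finrank ℂ H = 3) :
    {a : P4 | IsInflectionPoint f H a}.ncard = 9 := by
  rw [← ncard_isFlexVector (h.toIsSymmTrilinear.restrict H) hs hH,
    ← Set.ncard_image_of_injective _
      (Projectivization.map_injective H.subtype H.injective_subtype)]
  congr 1
  ext a
  simp only [Set.mem_ofPred_eq, h.isInflectionPoint_iff hs hH, Set.mem_image]
  constructor
  · rintro ⟨ha, hfl⟩
    have ha0 : (⟨a.rep, ha⟩ : H) ≠ 0 := by simpa using a.rep_nonzero
    refine ⟨Projectivization.mk ℂ ⟨a.rep, ha⟩ ha0, (isFlexVector_rep_mk_iff ha0).2 hfl, ?_⟩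
    rw [Projectivization.map_mk]
    exact a.mk_rep
  · rintro ⟨b, hb, rfl⟩
    induction b with | h v hv =>
    rw [isFlexVector_rep_mk_iff] at hb
    have hv' : (v : V) ≠ 0 := by simpa using hv
    rw [Projectivization.map_mk]
    obtain ⟨c, hc⟩ := Projectivization.exists_smul_eq_mk_rep ℂ (v : V) hv'
    rw [Units.smul_def] at hc
    have hmem : (Projectivization.mk ℂ (v : V) hv').rep ∈ H := by
      rw [← hc]
      exact H.smul_mem _ v.2
    refine ⟨hmem, ?_⟩
    have : (⟨(Projectivization.mk ℂ (v : V) hv').rep, hmem⟩ : H) = (c : ℂ) • v :=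
      Subtype.ext hc.symm
    exact this ▸ hb.smul _

end PlaneSection


/-! ### The cone at an Eckardt point and its rulings -/

section EckardtPoint

variable {f : MvPolynomial (Fin 5) ℂ} {T : V →ₗ[ℂ] V →ₗ[ℂ] V →ₗ[ℂ] ℂ} {p : P4}

theorem finrank_inf_ker_add_one {E : Type*} [AddCommGroup E] [Module ℂ E] [FiniteDimensional ℂ E]
    (W : Submodule ℂ E) (φ : E →ₗ[ℂ] ℂ) {w : E} (hw : w ∈ W) (hφ : φ w ≠ 0) :
    Module.finrank ℂ ↥(W ⊓ LinearMap.ker φ) + 1 = Module.finrank ℂ W := by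
  have h1 := (φ.domRestrict W).finrank_range_add_finrank_ker
  have h2 : LinearMap.range (φ.domRestrict W) = ⊤ :=
    LinearMap.range_eq_top.2 (LinearMap.surjective fun h => hφ (congrArg (fun ψ => ψ ⟨w, hw⟩) h))
  have h3 : (LinearMap.ker (φ.domRestrict W)).map W.subtype = W ⊓ LinearMap.ker φ := by
    ext x
    simp [and_comm]
  rw [h2, finrank_top, Module.finrank_self, ← Submodule.finrank_map_subtype_eq, h3] at h1
  omega

theorem finrank_span_sup_span {E : Type*} [AddCommGroup E] [Module ℂ E] [FiniteDimensional ℂ E]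
    {v w : E} (hv : v ≠ 0) (hw : w ∉ Submodule.span ℂ {v}) :
    Module.finrank ℂ ↥(Submodule.span ℂ {v} ⊔ Submodule.span ℂ {w}) = 2 := by
  have hw0 : w ≠ 0 := by
    rintro rfl
    exact hw (Submodule.zero_mem _)
  have hdisj : Submodule.span ℂ {v} ⊓ Submodule.span ℂ {w} = ⊥ := by
    rw [← disjoint_iff, Submodule.disjoint_span_singleton' hw0]
    exact hw
  have := Submodule.finrank_sup_add_finrank_inf_eq (Submodule.span ℂ {v}) (Submodule.span ℂ {w})
  rw [hdisj, finrank_bot, finrank_span_singleton hv, finrank_span_singleton hw0] at this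
  exact this

/-- At an Eckardt point, `X ∩ T_p X` is a cone. -/
theorem IsPolarization.apply_eq_zero_of_isEckardtPoint (h : IsPolarization f T)
    (hp : IsEckardtPoint f p) {w u : V} (hw : w ∈ tangentSpace f p) (hu : u ∈ tangentSpace f p) :
    T p.rep w u = 0 := by
  have h1 := h.three_le_multiplicityIn.1 hp.2.ge
  have h2 := (h1 (w + u) (add_mem hw hu)).2.2
  simp only [map_add, LinearMap.add_apply, (h1 w hw).2.2, (h1 u hu).2.2,
    h.swap_right p.rep u w] at h2
  linear_combination (1 / 2 : ℂ) * h2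

theorem IsPolarization.rep_mem_tangentSpace (h : IsPolarization f T) (hp : p ∈ zeroLocus f) :
    p.rep ∈ tangentSpace f p :=
  h.mem_tangentSpace.2 (h.mem_zeroLocus.1 hp)

theorem IsPolarization.tangentSpace_eq (h : IsPolarization f T) (p : P4) :
    tangentSpace f p = LinearMap.ker (T p.rep p.rep) := by
  ext w
  exact h.mem_tangentSpace

theorem IsPolarization.finrank_tangentSpace (h : IsPolarization f T) (hs : IsSmoothTrilinear T)
    (hp : p ∈ zeroLocus f) : Module.finrank ℂ (tangentSpace f p) = 4 := by
  obtain ⟨u, hu⟩ := hs p.rep p.rep_nonzero (h.mem_zeroLocus.1 hp)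
  have := finrank_inf_ker_add_one ⊤ (T p.rep p.rep) (Submodule.mem_top (x := u)) hu
  rw [top_inf_eq, finrank_top, Module.finrank_fin_fun] at this
  rw [h.tangentSpace_eq]
  omega

/-- By the modular law, a complement of p in the whole space cuts the tangent space in a complement
of p there. -/
theorem IsPolarization.exists_complement_in_tangentSpace (h : IsPolarization f T) (hs : IsSmoothTrilinear T)
    (hp : p ∈ zeroLocus f) : ∃ H : Submodule ℂ V, Module.finrank ℂ H = 3 ∧
      H ≤ tangentSpace f p ∧ ¬ p.submodule ≤ H := by
  obtain ⟨K, hK⟩ := Submodule.exists_isCompl p.submodule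
  have hle : p.submodule ≤ tangentSpace f p :=
    submodule_le_iff.2 (h.rep_mem_tangentSpace hp)
  refine ⟨K ⊓ tangentSpace f p, ?_, inf_le_right, fun hp' => ?_⟩
  · have h1 := Submodule.finrank_sup_add_finrank_inf_eq p.submodule (K ⊓ tangentSpace f p)
    rw [← sup_inf_assoc_of_le _ hle, hK.sup_eq_top, top_inf_eq, h.finrank_tangentSpace hs hp,
      ← inf_assoc, hK.inf_eq_bot, bot_inf_eq, finrank_bot, p.finrank_submodule] at h1
    omega
  · have h1 := hK.disjoint.eq_bot_of_le (hp'.trans inf_le_left)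
    have h2 := p.finrank_submodule
    rw [h1, finrank_bot] at h2
    omega

variable {H : Submodule ℂ V}

theorem IsPolarization.exists_eq_smul_add (h : IsPolarization f T) (hs : IsSmoothTrilinear T)
    (hp : p ∈ zeroLocus f) (hH : Module.finrank ℂ H = 3) (hHW : H ≤ tangentSpace f p)
    (hpH : ¬ p.submodule ≤ H) {w : V} (hw : w ∈ tangentSpace f p) :
    ∃ s : ℂ, ∃ a ∈ H, w = s • p.rep + a := by
  have hle : p.submodule ≤ tangentSpace f p :=
    submodule_le_iff.2 (h.rep_mem_tangentSpace hp)
  have hdisj : p.submodule ⊓ H = ⊥ := by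
    rw [← disjoint_iff, Projectivization.submodule_eq, disjoint_comm,
      Submodule.disjoint_span_singleton' p.rep_nonzero]
    rwa [submodule_le_iff] at hpH
  have h1 := Submodule.finrank_sup_add_finrank_inf_eq p.submodule H
  rw [hdisj, finrank_bot, p.finrank_submodule, hH] at h1
  have h2 : p.submodule ⊔ H = tangentSpace f p :=
    Submodule.eq_of_le_of_finrank_eq (sup_le hle hHW)
      (by rw [h.finrank_tangentSpace hs hp]; omega)
  rw [← h2, Projectivization.submodule_eq] at hw
  obtain ⟨y, hy, a, ha, rfl⟩ := Submodule.mem_sup.1 hw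
  obtain ⟨s, rfl⟩ := Submodule.mem_span_singleton.1 hy
  exact ⟨s, a, ha, rfl⟩

/-- Expanding, every term with p in some slot vanishes by the Eckardt condition, since p itself lies
in its tangent space. -/
theorem IsPolarization.apply_cone (h : IsPolarization f T) (hp : IsEckardtPoint f p)
    {x y z : V} (hx : x ∈ tangentSpace f p) (hy : y ∈ tangentSpace f p)
    (hz : z ∈ tangentSpace f p) (r s t : ℂ) :
    T (r • p.rep + x) (s • p.rep + y) (t • p.rep + z) = T x y z := by
  have hv := h.rep_mem_tangentSpace hp.1
  have e1 {w u : V} (hw : w ∈ tangentSpace f p) (hu : u ∈ tangentSpace f p) :=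
    h.apply_eq_zero_of_isEckardtPoint hp hw hu
  have e2 {w u : V} (hw : w ∈ tangentSpace f p) (hu : u ∈ tangentSpace f p) :
      T w p.rep u = 0 := by rw [h.swap_left, e1 hw hu]
  have e3 {w u : V} (hw : w ∈ tangentSpace f p) (hu : u ∈ tangentSpace f p) :
      T w u p.rep = 0 := by rw [h.swap_right, e2 hw hu]
  simp only [map_add, map_smul, LinearMap.add_apply, LinearMap.smul_apply, smul_eq_mul,
    e1 hv hv, e1 hv hz, e1 hy hv, e1 hy hz, e2 hx hv, e2 hx hz, e3 hx hy]
  ring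

/-- The base of the cone is smooth. -/
theorem IsPolarization.isSmoothTrilinear_restrict (h : IsPolarization f T)
    (hs : IsSmoothTrilinear T) (hp : IsEckardtPoint f p) (hHW : H ≤ tangentSpace f p)
    (hpH : ¬ p.submodule ≤ H) (hspan : ∀ w ∈ tangentSpace f p, ∃ s : ℂ, ∃ a ∈ H,
      w = s • p.rep + a) : IsSmoothTrilinear (restrictTrilinear T H) := by
  rintro ⟨a, ha⟩ ha0 haaa
  by_contra! hcon
  have ha0' : a ≠ 0 := fun h => ha0 (by simp [h])
  replace haaa : T a a a = 0 := haaa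
  replace hcon (w : V) (hw : w ∈ H) : T a a w = 0 := hcon ⟨w, hw⟩
  rw [submodule_le_iff] at hpH
  -- The tangent space and u span everything. Along the ruling through a singular point a of the
  -- base, the differential already vanishes on the tangent space; s is chosen as a root of the
  -- quadratic giving its value on u.
  obtain ⟨u, hu⟩ := hs p.rep p.rep_nonzero (h.mem_zeroLocus.1 hp.1)
  obtain ⟨k, hk⟩ := IsAlgClosed.exists_pow_nat_eq
    (discrim (T p.rep p.rep u) (2 * T p.rep a u) (T a a u)) (n := 2) (by norm_num)
  obtain ⟨s, hsq⟩ := exists_quadratic_eq_zero hu ⟨k, by rw [← hk, sq]⟩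
  have hx : s • p.rep + a ≠ 0 := by
    intro hx
    by_cases h0 : s = 0
    · exact ha0' (by simpa [h0] using hx)
    · refine hpH ?_
      have h1 : p.rep = s⁻¹ • (-a) := by
        rw [← eq_neg_of_add_eq_zero_left hx, smul_smul, inv_mul_cancel₀ h0, one_smul]
      rw [h1]
      exact H.smul_mem _ (H.neg_mem ha)
  have haW := hHW ha
  obtain ⟨y, hy⟩ := hs _ hx (by rw [h.apply_cone hp haW haW haW, haaa])
  refine hy ?_
  have hW (w : V) (hw : w ∈ tangentSpace f p) : T (s • p.rep + a) (s • p.rep + a) w = 0 := by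
    obtain ⟨t, b, hb, rfl⟩ := hspan w hw
    rw [h.apply_cone hp haW haW (hHW hb), hcon b hb]
  have hU : T (s • p.rep + a) (s • p.rep + a) u = 0 := by
    simp only [map_add, map_smul, LinearMap.add_apply, LinearMap.smul_apply, smul_eq_mul,
      h.swap_left a p.rep]
    linear_combination hsq
  have h1 := hW (y - (T p.rep p.rep y / T p.rep p.rep u) • u)
    (h.mem_tangentSpace.2 (by simp [hu]))
  rwa [map_sub, map_smul, hU, smul_zero, sub_zero] at h1

theorem IsPolarization.tangentSpace_mk (h : IsPolarization f T) {a : V} (ha : a ≠ 0) :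
    tangentSpace f (Projectivization.mk ℂ a ha) = LinearMap.ker (T a a) := by
  obtain ⟨c, hc⟩ := Projectivization.exists_smul_eq_mk_rep ℂ a ha
  rw [Units.smul_def] at hc
  ext w
  simp [h.mem_tangentSpace, ← hc]

/-- The unique plane tangent to `X` along a ruling of the cone `X ∩ T_p X`. -/
theorem IsPolarization.isPlaneTangentAlong_iff (h : IsPolarization f T)
    (hs : IsSmoothTrilinear T) (hp : IsEckardtPoint f p) (hHW : H ≤ tangentSpace f p)
    (hsH : IsSmoothTrilinear (restrictTrilinear T H)) {a : V} (ha : a ∈ H) (ha0 : a ≠ 0)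
    (haaa : T a a a = 0) {P : Submodule ℂ V} :
    IsPlaneTangentAlong f (p.submodule ⊔ Submodule.span ℂ {a}) P ↔
      P = tangentSpace f p ⊓ LinearMap.ker (T a a) := by
  have hv := h.rep_mem_tangentSpace hp.1
  obtain ⟨⟨b, hb⟩, hab⟩ := hsH ⟨a, ha⟩ (by simpa using ha0) haaa
  have hfin : Module.finrank ℂ ↥(tangentSpace f p ⊓ LinearMap.ker (T a a)) = 3 := by
    have := finrank_inf_ker_add_one (tangentSpace f p) (T a a) (hHW hb) hab
    rw [h.finrank_tangentSpace hs hp.1] at this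
    omega
  have haav : T a a p.rep = 0 := by
    rw [h.swap_right, h.swap_left, h.apply_eq_zero_of_isEckardtPoint hp (hHW ha) (hHW ha)]
  constructor
  · rintro ⟨hP, -, ht⟩
    -- Tangency at p and at a alone confines P to the intersection of two tangent spaces, which
    -- already has dimension three.
    refine Submodule.eq_of_le_of_finrank_eq (le_inf (ht p le_sup_left) ?_) (hP.trans hfin.symm)
    rw [← h.tangentSpace_mk ha0]
    exact ht _ (by rw [Projectivization.submodule_mk]; exact le_sup_right)
  · rintro rfl
    refine ⟨hfin, sup_le (submodule_le_iff.2 ⟨hv, haav⟩) ?_, fun q hq => ?_⟩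
    · rw [Submodule.span_singleton_le_iff_mem]
      exact ⟨hHW ha, haaa⟩
    · rintro w ⟨hw, haw⟩
      rw [submodule_le_iff, Projectivization.submodule_eq] at hq
      obtain ⟨y, hy, z, hz, hyz⟩ := Submodule.mem_sup.1 hq
      obtain ⟨s, rfl⟩ := Submodule.mem_span_singleton.1 hy
      obtain ⟨t, rfl⟩ := Submodule.mem_span_singleton.1 hz
      have hta := (tangentSpace f p).smul_mem t (hHW ha)
      rw [h.mem_tangentSpace, ← hyz]
      have := h.apply_cone hp hta hta hw s s 0
      rw [zero_smul, zero_add] at this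
      rw [this]
      replace haw : T a a w = 0 := haw
      simp [haw]

theorem IsPolarization.apply_self_eq_zero_of_isLineOn (h : IsPolarization f T)
    {ℓ : Submodule ℂ V} (hℓ : IsLineOn f ℓ) {x : V} (hx : x ∈ ℓ) : T x x x = 0 := by
  by_cases hx0 : x = 0
  · simp [hx0]
  · have h1 := h.mem_zeroLocus.1 (hℓ.2 (Projectivization.mk ℂ x hx0)
      (by rwa [Projectivization.submodule_mk, Submodule.span_singleton_le_iff_mem]))
    obtain ⟨c, hc⟩ := Projectivization.exists_smul_eq_mk_rep ℂ x hx0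
    rw [← hc, Units.smul_def] at h1
    simpa using h1

theorem IsPolarization.apply_add_self (h : IsPolarization f T) (x y : V) :
    T (x + y) (x + y) (x + y) = T x x x + 3 * T x x y + 3 * T x y y + T y y y := by
  simp only [map_add, LinearMap.add_apply, h.swap_left y x, h.swap_right x y x,
    h.swap_right y y x]
  ring

/-- A line on `X` through `p` is a ruling of the cone `X ∩ T_p X`. -/
theorem IsPolarization.exists_eq_sup_span_of_isLineOn (h : IsPolarization f T)
    (hspan : ∀ w ∈ tangentSpace f p, ∃ s : ℂ, ∃ a ∈ H, w = s • p.rep + a)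
    {ℓ : Submodule ℂ V} (hℓ : IsLineOn f ℓ) (hpℓ : p.submodule ≤ ℓ) :
    ∃ a ∈ H, a ≠ 0 ∧ T a a a = 0 ∧ ℓ = p.submodule ⊔ Submodule.span ℂ {a} := by
  have hv := submodule_le_iff.1 hpℓ
  have hle : ℓ ≤ tangentSpace f p := by
    intro w hw
    rw [h.mem_tangentSpace]
    -- The difference of f(v + w) and f(v - w), corrected by f(w), isolates T(v, v, w).
    have e1 := h.apply_self_eq_zero_of_isLineOn hℓ (add_mem hv hw)
    have e2 := h.apply_self_eq_zero_of_isLineOn hℓ (add_mem hv (neg_mem hw))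
    have e3 := h.apply_self_eq_zero_of_isLineOn hℓ hv
    have e4 := h.apply_self_eq_zero_of_isLineOn hℓ hw
    rw [h.apply_add_self] at e1 e2
    simp only [map_neg, LinearMap.neg_apply, neg_neg] at e2
    linear_combination (1 / 6 : ℂ) * e1 - (1 / 6 : ℂ) * e2 - (1 / 3 : ℂ) * e4
  obtain ⟨w, hw, hwp⟩ : ∃ w ∈ ℓ, w ∉ p.submodule := by
    by_contra! hcon
    have h1 := Submodule.finrank_mono (show ℓ ≤ _ from hcon)
    rw [hℓ.1, p.finrank_submodule] at h1
    omega
  obtain ⟨s, a, ha, rfl⟩ := hspan w (hle hw)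
  rw [Projectivization.submodule_eq] at hwp
  have haℓ : a ∈ ℓ := by
    have := sub_mem hw (ℓ.smul_mem s hv)
    rwa [add_sub_cancel_left] at this
  have hap : a ∉ Submodule.span ℂ {p.rep} := fun ha' => hwp
    (add_mem (Submodule.smul_mem _ _ (Submodule.mem_span_singleton_self _)) ha')
  refine ⟨a, ha, ?_, h.apply_self_eq_zero_of_isLineOn hℓ haℓ, Eq.symm ?_⟩
  · rintro rfl
    exact hap (Submodule.zero_mem _)
  · refine Submodule.eq_of_le_of_finrank_eq
      (sup_le hpℓ (by rwa [Submodule.span_singleton_le_iff_mem])) ?_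
    rw [hℓ.1, Projectivization.submodule_eq, finrank_span_sup_span p.rep_nonzero hap]

/-- The ruling of the cone through a point of the base is a triple line exactly at the flexes. -/
theorem IsPolarization.isTripleLine_iff (h : IsPolarization f T)
    (hs : IsSmoothTrilinear T) (hp : IsEckardtPoint f p) (hH : Module.finrank ℂ H = 3)
    (hHW : H ≤ tangentSpace f p) (hpH : ¬ p.submodule ≤ H)
    (hspan : ∀ w ∈ tangentSpace f p, ∃ s : ℂ, ∃ a ∈ H, w = s • p.rep + a)
    (hsH : IsSmoothTrilinear (restrictTrilinear T H)) {a : V} (ha : a ∈ H) (ha0 : a ≠ 0)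
    (haaa : T a a a = 0) : IsTripleLine f (p.submodule ⊔ Submodule.span ℂ {a}) ↔
      IsFlexVector (restrictTrilinear T H) ⟨a, ha⟩ := by
  have hv := h.rep_mem_tangentSpace hp.1
  have haH0 : (⟨a, ha⟩ : H) ≠ 0 := by simpa using ha0
  have hT := h.toIsSymmTrilinear.restrict H
  have hplane {P : Submodule ℂ V} :=
    h.isPlaneTangentAlong_iff hs hp hHW hsH ha ha0 haaa (P := P)
  constructor
  · rintro ⟨-, -, P, hP, α, β, hα, hβ, hfact⟩
    rw [h.isFlexVector_iff hsH hH haH0]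
    refine ⟨haaa, fun w hw haw => ?_⟩
    have haℓ : a ∈ p.submodule ⊔ Submodule.span ℂ {a} :=
      le_sup_right (a := p.submodule) (Submodule.mem_span_singleton_self a)
    have haα : α a = 0 := (hα.symm ▸ haℓ : a ∈ P ⊓ LinearMap.ker α).2
    have haβ : β a = 0 := (hβ.symm ▸ haℓ : a ∈ P ⊓ LinearMap.ker β).2
    have hPa : a ∈ P := hP.2.1 haℓ
    have hPw : w ∈ P := by
      rw [hplane.1 hP]
      exact ⟨hHW hw, haw⟩
    -- Both linear forms vanish at a, so f(a + w) = f(w); expanding leaves 3 T(a, w, w) = 0.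
    have e1 := hfact _ (add_mem hPa hPw)
    have e2 := hfact w hPw
    rw [h.eval_eq] at e1 e2
    rw [h.apply_add_self, map_add, map_add, haα, haβ, zero_add, zero_add, ← e2, haaa] at e1
    replace haw : T a a w = 0 := haw
    rw [haw] at e1
    linear_combination (1 / 3 : ℂ) * e1
  · rintro ⟨-, ⟨b, hb⟩, hb0, hab⟩
    have hbbb : T b b b ≠ 0 := apply_self_ne_zero_of_flex hT hsH hH haH0 haaa hb0 hab
    have habu (u : V) (hu : u ∈ H) : T a b u = 0 := hab ⟨u, hu⟩
    have haav : T a a p.rep = 0 := by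
      rw [h.swap_right, h.swap_left, h.apply_eq_zero_of_isEckardtPoint hp (hHW ha) (hHW ha)]
    have hbbv : T b b p.rep = 0 := by
      rw [h.swap_right, h.swap_left, h.apply_eq_zero_of_isEckardtPoint hp (hHW hb) (hHW hb)]
    have hbba : T b b a = 0 := by rw [h.swap_right, h.swap_left, habu b hb]
    have hap : a ∉ Submodule.span ℂ {p.rep} := by
      intro hap
      obtain ⟨c, rfl⟩ := Submodule.mem_span_singleton.1 hap
      have hc : c ≠ 0 := by
        rintro rfl
        exact ha0 (zero_smul _ _)
      exact hpH (submodule_le_iff.2 ((H.smul_mem_iff hc).1 ha))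
    have hfin : Module.finrank ℂ ↥(p.submodule ⊔ Submodule.span ℂ {a}) = 2 := by
      rw [Projectivization.submodule_eq, finrank_span_sup_span p.rep_nonzero hap]
    have hline : IsLineOn f (p.submodule ⊔ Submodule.span ℂ {a}) := by
      refine ⟨hfin, fun q hq => ?_⟩
      rw [submodule_le_iff, Projectivization.submodule_eq] at hq
      obtain ⟨y, hy, z, hz, hyz⟩ := Submodule.mem_sup.1 hq
      obtain ⟨s, rfl⟩ := Submodule.mem_span_singleton.1 hy
      obtain ⟨t, rfl⟩ := Submodule.mem_span_singleton.1 hz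
      have hta := (tangentSpace f p).smul_mem t (hHW ha)
      rw [h.mem_zeroLocus, ← hyz, h.apply_cone hp hta hta hta]
      simp [haaa]
    refine ⟨⟨hline, _, hplane.2 rfl, fun P hP => hplane.1 hP⟩, hfin, _, hplane.2 rfl, ?_⟩
    have hexp (x : V) (hx : x ∈ tangentSpace f p ⊓ LinearMap.ker (T a a)) :
        ∃ r s t : ℂ, x = r • p.rep + (s • a + t • b) := by
      obtain ⟨hxW, hx⟩ := hx
      obtain ⟨r, y, hy, rfl⟩ := hspan x hxW
      have hay : T a a y = 0 := by
        replace hx : T a a (r • p.rep + y) = 0 := hx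
        simpa [haav] using hx
      obtain ⟨s, t, hst⟩ := exists_eq_add_of_flex hT hsH hH haH0 haaa hb0 hab (u := ⟨y, hy⟩) hay
      exact ⟨r, s, t, by rw [show y = s • a + t • b from congrArg Subtype.val hst]⟩
    have hcut : tangentSpace f p ⊓ LinearMap.ker (T a a) ⊓ LinearMap.ker (T b b) =
        p.submodule ⊔ Submodule.span ℂ {a} := by
      refine le_antisymm ?_ (sup_le ?_ ?_)
      · rintro x ⟨hx, hbx⟩
        obtain ⟨r, s, t, rfl⟩ := hexp x hx
        replace hbx : T b b (r • p.rep + (s • a + t • b)) = 0 := hbx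
        have ht : t = 0 := by simpa [hbbv, hbba, hbbb] using hbx
        rw [ht, zero_smul, add_zero, Projectivization.submodule_eq]
        exact Submodule.add_mem_sup
          (Submodule.smul_mem _ _ (Submodule.mem_span_singleton_self _))
          (Submodule.smul_mem _ _ (Submodule.mem_span_singleton_self _))
      · exact submodule_le_iff.2 ⟨⟨hv, haav⟩, hbbv⟩
      · rw [Submodule.span_singleton_le_iff_mem]
        exact ⟨⟨hHW ha, haaa⟩, hbba⟩
    -- On r•p + s•a + t•b the form f is t³ T(b, b, b), while `T b b` takes the value t T(b, b, b).
    -- The scaled form is therefore the coordinate t, and its square times `T b b` is f.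
    refine ⟨(T b b b)⁻¹ • T b b, T b b, ?_, hcut, fun x hx => ?_⟩
    · rw [LinearMap.ker_smul _ _ (inv_ne_zero hbbb), hcut]
    · obtain ⟨r, s, t, rfl⟩ := hexp x hx
      have hst := (tangentSpace f p).add_mem ((tangentSpace f p).smul_mem s (hHW ha))
        ((tangentSpace f p).smul_mem t (hHW hb))
      rw [h.eval_eq, h.apply_cone hp hst hst hst, h.apply_add_self]
      have haab : T a a b = 0 := by rw [h.swap_right, habu a ha]
      simp only [map_add, map_smul, LinearMap.smul_apply, smul_eq_mul, haaa, haab, habu b hb,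
        hbbv, hbba]
      field_simp
      ring

theorem IsPolarization.mem_linearSection_tangentSpace_iff (h : IsPolarization f T)
    (hp : IsEckardtPoint f p) (hHW : H ≤ tangentSpace f p)
    (hspan : ∀ w ∈ tangentSpace f p, ∃ s : ℂ, ∃ a ∈ H, w = s • p.rep + a)
    (hne : (linearSection f H).Nonempty) (q : P4) :
    q ∈ linearSection f (tangentSpace f p) ↔
      ∃ a ∈ linearSection f H, q.submodule ≤ p.submodule ⊔ a.submodule := by
  constructor
  · rintro ⟨hq, hqW⟩
    rw [submodule_le_iff] at hqW
    obtain ⟨s, a, ha, hsa⟩ := hspan _ hqW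
    -- Here q is the vertex p, which lies on a ruling only once the base is known to have a point.
    by_cases ha0 : a = 0
    · obtain ⟨a', ha'⟩ := hne
      refine ⟨a', ha', le_trans ?_ le_sup_left⟩
      rw [submodule_le_iff, hsa, ha0, add_zero, Projectivization.submodule_eq]
      exact Submodule.smul_mem _ _ (Submodule.mem_span_singleton_self _)
    · have haW := hHW ha
      refine ⟨Projectivization.mk ℂ a ha0, ⟨?_, ?_⟩, ?_⟩
      · obtain ⟨c, hc⟩ := Projectivization.exists_smul_eq_mk_rep ℂ a ha0
        rw [h.mem_zeroLocus, hsa, h.apply_cone hp haW haW haW] at hq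
        rw [h.mem_zeroLocus, ← hc, Units.smul_def]
        simp [hq]
      · rwa [Projectivization.submodule_mk, Submodule.span_singleton_le_iff_mem]
      · rw [submodule_le_iff, hsa, Projectivization.submodule_eq, Projectivization.submodule_mk]
        exact Submodule.add_mem_sup
          (Submodule.smul_mem _ _ (Submodule.mem_span_singleton_self _))
          (Submodule.mem_span_singleton_self _)
  · rintro ⟨a, ⟨ha, haH⟩, hq⟩
    rw [submodule_le_iff] at haH
    rw [submodule_le_iff, p.submodule_eq, a.submodule_eq] at hq
    obtain ⟨y, hy, z, hz, hyz⟩ := Submodule.mem_sup.1 hq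
    obtain ⟨s, rfl⟩ := Submodule.mem_span_singleton.1 hy
    obtain ⟨t, rfl⟩ := Submodule.mem_span_singleton.1 hz
    have hta := (tangentSpace f p).smul_mem t (hHW haH)
    rw [h.mem_zeroLocus] at ha
    refine ⟨?_, ?_⟩
    · rw [h.mem_zeroLocus, ← hyz, h.apply_cone hp hta hta hta]
      simp [ha]
    · rw [submodule_le_iff, ← hyz]
      exact add_mem (Submodule.smul_mem _ _ (h.rep_mem_tangentSpace hp.1)) hta

/-- The point a is recovered as the intersection of its ruling with H, by the modular law. -/
theorem injOn_sup_submodule (hpH : ¬ p.submodule ≤ H) :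
    Set.InjOn (fun a : P4 => p.submodule ⊔ a.submodule) {a | a.submodule ≤ H} := by
  have hdisj : p.submodule ⊓ H = ⊥ := by
    rw [← disjoint_iff, Projectivization.submodule_eq, disjoint_comm,
      Submodule.disjoint_span_singleton' p.rep_nonzero]
    rwa [submodule_le_iff] at hpH
  intro a ha b hb hab
  have key (c : P4) (hc : c.submodule ≤ H) : (p.submodule ⊔ c.submodule) ⊓ H = c.submodule := by
    rw [sup_comm, sup_inf_assoc_of_le _ hc, hdisj, sup_bot_eq]
  exact Projectivization.submodule_injective
    (by rw [← key a ha, ← key b hb]; exact congrArg (· ⊓ H) hab)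

theorem IsPolarization.bijOn_isInflectionPoint (h : IsPolarization f T)
    (hs : IsSmoothTrilinear T) (hp : IsEckardtPoint f p) (hH : Module.finrank ℂ H = 3)
    (hHW : H ≤ tangentSpace f p) (hpH : ¬ p.submodule ≤ H)
    (hspan : ∀ w ∈ tangentSpace f p, ∃ s : ℂ, ∃ a ∈ H, w = s • p.rep + a)
    (hsH : IsSmoothTrilinear (restrictTrilinear T H)) :
    Set.BijOn (fun a : P4 => p.submodule ⊔ a.submodule) {a : P4 | IsInflectionPoint f H a}
      {ℓ : Submodule ℂ V | IsTripleLine f ℓ ∧ p.submodule ≤ ℓ} := by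
  refine ⟨fun a ha => ⟨?_, le_sup_left⟩, (injOn_sup_submodule hpH).mono fun a ha => ha.1.2, ?_⟩
  · obtain ⟨haH, hfl⟩ := (h.isInflectionPoint_iff hsH hH).1 ha
    beta_reduce
    rw [a.submodule_eq]
    exact (h.isTripleLine_iff hs hp hH hHW hpH hspan hsH haH a.rep_nonzero hfl.1).2 hfl
  · rintro ℓ ⟨hℓ, hpℓ⟩
    obtain ⟨a, ha, ha0, haaa, rfl⟩ := h.exists_eq_sup_span_of_isLineOn hspan hℓ.1.1 hpℓ
    have hfl := (h.isTripleLine_iff hs hp hH hHW hpH hspan hsH ha ha0 haaa).1 hℓ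
    refine ⟨Projectivization.mk ℂ a ha0, ?_, ?_⟩
    · obtain ⟨c, hc⟩ := Projectivization.exists_smul_eq_mk_rep ℂ a ha0
      rw [Units.smul_def] at hc
      have hmem : (Projectivization.mk ℂ a ha0).rep ∈ H := by
        rw [← hc]
        exact H.smul_mem _ ha
      refine (h.isInflectionPoint_iff hsH hH).2 ⟨hmem, ?_⟩
      have : (⟨(Projectivization.mk ℂ a ha0).rep, hmem⟩ : H) = (c : ℂ) • ⟨a, ha⟩ :=
        Subtype.ext hc.symm
      exact this ▸ hfl.smul _
    · beta_reduce
      rw [Projectivization.submodule_mk]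

end EckardtPoint

end CubicThreefold

/-! ### The main theorem -/

theorem mainTheorem3 (f : MvPolynomial (Fin 5) ℂ) (hf : CubicThreefold.IsSmoothCubic f)
    (p : CubicThreefold.P4) (hp : CubicThreefold.IsEckardtPoint f p) :
    -- exactly nine triple lines pass through `p`
    {ℓ : Submodule ℂ CubicThreefold.V |
        CubicThreefold.IsTripleLine f ℓ ∧ p.submodule ≤ ℓ}.ncard = 9 ∧
    -- for every 2-plane `H` in `T_p X` that misses `p`, with `E_p = X ∩ H`:
    ∀ H : Submodule ℂ CubicThreefold.V, Module.finrank ℂ H = 3 →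
      H ≤ CubicThreefold.tangentSpace f p → ¬ p.submodule ≤ H →
      -- `X ∩ T_p X` is the cone with vertex `p` over `E_p`
      (∀ q : CubicThreefold.P4,
        (q ∈ CubicThreefold.linearSection f (CubicThreefold.tangentSpace f p) ↔
          ∃ a ∈ CubicThreefold.linearSection f H, q.submodule ≤ p.submodule ⊔ a.submodule)) ∧
      -- `E_p` is a smooth plane cubic
      CubicThreefold.IsSmoothSection f H ∧
      -- `E_p` has exactly nine inflection points
      {a : CubicThreefold.P4 | CubicThreefold.IsInflectionPoint f H a}.ncard = 9 ∧
      -- the inflection points correspond to the triple lines through `p`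
      Set.BijOn (fun a : CubicThreefold.P4 => p.submodule ⊔ a.submodule)
        {a : CubicThreefold.P4 | CubicThreefold.IsInflectionPoint f H a}
        {ℓ : Submodule ℂ CubicThreefold.V |
          CubicThreefold.IsTripleLine f ℓ ∧ p.submodule ≤ ℓ} := by
  obtain ⟨T, hT⟩ := CubicThreefold.exists_isPolarization hf.1
  have hs := hT.isSmoothTrilinear hf
  have key (H : Submodule ℂ CubicThreefold.V) (hH : Module.finrank ℂ H = 3)
      (hHW : H ≤ CubicThreefold.tangentSpace f p) (hpH : ¬ p.submodule ≤ H) :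
      (∀ w ∈ CubicThreefold.tangentSpace f p, ∃ s : ℂ, ∃ a ∈ H, w = s • p.rep + a) ∧
        CubicThreefold.IsSmoothTrilinear (CubicThreefold.restrictTrilinear T H) := by
    have hspan := fun w hw => hT.exists_eq_smul_add hs hp.1 hH hHW hpH (w := w) hw
    exact ⟨hspan, hT.isSmoothTrilinear_restrict hs hp hHW hpH hspan⟩
  refine ⟨?_, fun H hH hHW hpH => ?_⟩
  -- The count of triple lines does not involve H, but it is read off from an auxiliary plane
  -- section.
  · obtain ⟨H, hH, hHW, hpH⟩ := hT.exists_complement_in_tangentSpace hs hp.1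
    obtain ⟨hspan, hsH⟩ := key H hH hHW hpH
    have hbij := hT.bijOn_isInflectionPoint hs hp hH hHW hpH hspan hsH
    rw [← hbij.image_eq, hbij.injOn.ncard_image, hT.ncard_isInflectionPoint hsH hH]
  · obtain ⟨hspan, hsH⟩ := key H hH hHW hpH
    have h9 := hT.ncard_isInflectionPoint hsH hH
    -- Having nine inflection points, the base is nonempty, as the cone description requires at its
    -- vertex.
    obtain ⟨a, ha⟩ := Set.nonempty_of_ncard_ne_zero (by rw [h9]; norm_num)
    exact ⟨hT.mem_linearSection_tangentSpace_iff hp hHW hspan ⟨a, ha.1⟩,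
      hT.isSmoothSection_iff.2 hsH, h9,
      hT.bijOn_isInflectionPoint hs hp hH hHW hpH hspan hsH⟩
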